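/- **Setting.** Let $p\ge 1$, $r_1,\dots,r_p$ be positive integers, $\mathcal R=[r_1]\times\cdots\times[r_p]$, and let $\langle\cdot,\cdot\rangle$ be the entrywise inner product on tensors $\psi=(\psi_x)_{x\in\mathcal R}\in\mathbb R^{r_1\times\cdots\times r_p}$. For $\lambda\ge 0$ let $\mathcal B_\lambda$ (resp. $\mathcal S_\lambda$) be the set of tensors $\psi_x=\lambda\prod_{k=1}^p\theta^{(k)}_{x_k}$ with all $\theta^{(k)}_j\in[-1,1]$ (resp. all $\theta^{(k)}_j\in\{-1,1\}$), let $\mathcal C_\lambda=\mathrm{conv}(\mathcal B_\lambda)$, and let $\|\psi\|_\pm=\inf\{s\ge 0:\psi\in s\,\mathcal C_1\}$. Given $n\ge 1$ observations $(x\langle i\rangle,y\langle i\rangle)\in\mathcal R\times\mathbb R$, the tensor completion problem is $$\min_\psi\ F(\psi)=\frac1n\sum_{i=1}^n\bigl(y\langle i\rangle-\psi_{x\langle i\rangle}\bigr)^2\quad\text{s.t. } \|\psi\|_\pm\le\lambda .$$ Let $U=\{x\langle 1\rangle,\dots,x\langle n\rangle\}$ be the set of distinct observed indices, let $\mathrm{Proj}_U$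 be the projection onto the entries in $U$, and let $f(u)=\frac1n\sum_i(y\langle i\rangle-u_{x\langle i\rangle})^2$ for $u\in\mathbb R^U$. **Weak separation oracle.** For fixed accuracy $K\ge 1$, a call with input $c$, $\psi\in\mathcal C_\lambda$, $\Phi>0$ returns either some $\varphi\in\mathcal S_\lambda$ with $\langle c,\psi-\varphi\rangle\ge\Phi/K$, or **false**, in which case $\langle c,\psi-\varphi\rangle\le\Phi$ for all $\varphi\in\mathcal C_\lambda$. Answers may vary from call to call. It is used on $\mathrm{Proj}_U(\mathcal C_\lambda)$ by extending $c\in\mathbb R^U$ by zero, replacing the point by any tensor in $\mathcal C_\lambda$ projecting to it, and projecting the answer. **Blended Conditional Gradients (BCG)** with tolerance $\varepsilon>0$, for $f$ over $P=\mathrm{Proj}_U(\{\|\psi\|_\pm\le\lambda\})$: start at $u_0\in\mathrm{Proj}_U(\mathcal S_\lambda)$ with active set $S=\{u_0\}$ and a gap estimate $\Phi=\Phi_0\ge\tfrac12\max_{v\in P}\langle\nabla f(u_0),u_0-v\rangle$. While $2\Phi>\varepsilon$, at the current iterate $u$: 1. If $\max_{a,b\in S}\langle\nabla f(u),a-b\rangle\ge\Phi$,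 perform a simplex gradient descent step (no oracle call): write $u=\sum_{v\in S}w_vv$ as a convex combination, put $d_v=\langle\nabla f(u),v\rangle-\frac1{|S|}\sum_{v'\in S}\langle\nabla f(u),v'\rangle$, let $\eta$ be the largest $t\ge0$ with $w-td\ge0$ and $z=u-\eta\sum_{v\in S} d_vv$; if $f(z)\le f(u)$, move to $z$ and replace $S$ by some $S'\subsetneq S$ with $z\in\mathrm{conv}(S')$; otherwise move to a minimizer of $f$ on $[u,z]$ and keep $S$. 2. Otherwise call the oracle with $\nabla f(u),u,\Phi$. If it answers **false**, replace $\Phi$ by $\Phi/2$. If it returns $v$, move to a minimizer $u'$ of $f$ on $[u,v]$ and replace $S$ by an inclusion-minimal $S'\subseteq S\cup\{v\}$ with $u'\in\mathrm{conv}(S')$. **Proposition.** (a) $\mathrm{Proj}_U(\{\|\psi\|_\pm\le\lambda\})=\mathrm{conv}(\mathrm{Proj}_U(\mathcal S_\lambda))$ is a polytope ($\mathrm{Proj}_U(\mathcal S_\lambda)$ is finite), $F(\psi)=f(\mathrm{Proj}_U\psi)$ for all $\psi$, and $f$ is strictly convex on this polytope. (b) There is a constant $C>0$, depending only on $p$,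 $(r_k)$, $n$, $(x\langle i\rangle)$, $\lambda$ and $K$, such that for all $y\in\mathbb R^n$, all weak separation oracles with accuracy $K$, all starting vertices, all admissible $\Phi_0$, all $\varepsilon>0$ and all choices made by the algorithm: BCG never gets stuck before its stopping rule $2\Phi\le\varepsilon$ holds, it terminates after finitely many steps, it makes at most $$C\,\bigl(1+\log(1+\Phi_0/\varepsilon)\bigr)$$ oracle calls, and its final iterate $u$ lies in $\mathrm{Proj}_U(\{\|\psi\|_\pm\le\lambda\})$, with every tensor $\psi$ such that $\|\psi\|_\pm\le\lambda$ and $\mathrm{Proj}_U\psi=u$ satisfying $F(\psi)\le F(\varphi)+\varepsilon$ for all $\varphi$ with $\|\varphi\|_\pm\le\lambda$. -/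

import Mathlib

open scoped Pointwise

noncomputable section

namespace TensorCompletion

/-! ### Tensors, rank-one tensors and the gauge norm -/

/-- The index set `[r₁] × ⋯ × [r_p]`. -/
abbrev Idx {p : ℕ} (r : Fin p → ℕ) : Type := (k : Fin p) → Fin (r k)

/-- Real tensors of size `r₁ × ⋯ × r_p`, with the entrywise (flattened) inner product. -/
abbrev Tensor {p : ℕ} (r : Fin p → ℕ) : Type := EuclideanSpace ℝ (Idx r)

/-- Tensors `ψ_x = λ ∏ₖ θ⁽ᵏ⁾_{x_k}` with all `θ⁽ᵏ⁾_j ∈ [-1, 1]`. -/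
def rankOneBox {p : ℕ} (r : Fin p → ℕ) (lam : ℝ) : Set (Tensor r) :=
  {ψ | ∃ θ : (k : Fin p) → Fin (r k) → ℝ,
    (∀ k j, θ k j ∈ Set.Icc (-1 : ℝ) 1) ∧ ∀ x : Idx r, ψ x = lam * ∏ k, θ k (x k)}

/-- Tensors `ψ_x = λ ∏ₖ θ⁽ᵏ⁾_{x_k}` with all `θ⁽ᵏ⁾_j ∈ {-1, 1}`. -/
def rankOneSign {p : ℕ} (r : Fin p → ℕ) (lam : ℝ) : Set (Tensor r) :=
  {ψ | ∃ θ : (k : Fin p) → Fin (r k) → ℝ,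
    (∀ k j, θ k j = -1 ∨ θ k j = 1) ∧ ∀ x : Idx r, ψ x = lam * ∏ k, θ k (x k)}

/-- `C_λ`, the convex hull of the rank-one tensors with entries bounded by `λ`. -/
def hull {p : ℕ} (r : Fin p → ℕ) (lam : ℝ) : Set (Tensor r) :=
  convexHull ℝ (rankOneBox r lam)

/-- The gauge norm `‖ψ‖_± = inf {s ≥ 0 | ψ ∈ s C₁}`. -/
def gaugeNorm {p : ℕ} {r : Fin p → ℕ} (ψ : Tensor r) : ℝ :=
  sInf {s : ℝ | 0 ≤ s ∧ ψ ∈ s • hull r 1}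

/-- The feasible set `‖ψ‖_± ≤ λ` of the tensor completion problem. -/
def feasible {p : ℕ} (r : Fin p → ℕ) (lam : ℝ) : Set (Tensor r) :=
  {ψ | gaugeNorm ψ ≤ lam}

/-- The least squares objective `(1/n) ∑ᵢ (y⟨i⟩ - ψ_{x⟨i⟩})²`. -/
def objective {p n : ℕ} {r : Fin p → ℕ} (x : Fin n → Idx r) (y : Fin n → ℝ) (ψ : Tensor r) : ℝ :=
  (1 / (n : ℝ)) * ∑ i, (y i - ψ (x i)) ^ 2

/-! ### Projection onto the observed entries -/

/-- The set `U` of distinct observed indices. -/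
abbrev Observed {p n : ℕ} {r : Fin p → ℕ} (x : Fin n → Idx r) : Type :=
  {z : Idx r // z ∈ Finset.univ.image x}

/-- The observed index `x⟨i⟩`, as an element of `U`. -/
def observedIdx {p n : ℕ} {r : Fin p → ℕ} (x : Fin n → Idx r) (i : Fin n) : Observed x :=
  ⟨x i, Finset.mem_image_of_mem x (Finset.mem_univ i)⟩

/-- The coordinate projection `Proj_U`. -/
def proj {p n : ℕ} {r : Fin p → ℕ} (x : Fin n → Idx r) (ψ : Tensor r) :
    EuclideanSpace ℝ (Observed x) :=
  WithLp.toLp 2 fun z => ψ z.1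

/-- Extension by zero of a vector on `U` to a tensor (the adjoint of `Proj_U`). -/
def extendZero {p n : ℕ} {r : Fin p → ℕ} (x : Fin n → Idx r)
    (c : EuclideanSpace ℝ (Observed x)) : Tensor r :=
  WithLp.toLp 2 fun z => if h : z ∈ Finset.univ.image x then c ⟨z, h⟩ else 0

/-- The least squares objective as a function of the observed entries only. -/
def projObjective {p n : ℕ} {r : Fin p → ℕ} (x : Fin n → Idx r) (y : Fin n → ℝ)
    (u : EuclideanSpace ℝ (Observed x)) : ℝ :=
  (1 / (n : ℝ)) * ∑ i, (y i - u (observedIdx x i)) ^ 2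

/-! ### The weak separation oracle -/

/-- A weak separation oracle for `C_λ` with accuracy `K`. On input of a linear objective `c`, a
point `ψ ∈ C_λ` and a gap estimate `Φ > 0` it returns either `some φ` with `φ` a sign vertex and
`⟨c, ψ - φ⟩ ≥ Φ / K`, or `none` (that is, **false**), in which case `⟨c, ψ - φ⟩ ≤ Φ` on `C_λ`.
The first argument of `answer` is the number of the call, so that the oracle need not answer
equal queries equally (it may use randomised heuristics, warm starts, ...). -/
structure WeakSeparationOracle {p : ℕ} (r : Fin p → ℕ) (lam K : ℝ) where
  answer : ℕ → Tensor r → Tensor r → ℝ → Option (Tensor r)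
  sound_vertex : ∀ (j : ℕ) (c ψ : Tensor r) (Φ : ℝ) (φ : Tensor r), ψ ∈ hull r lam → 0 < Φ →
    answer j c ψ Φ = some φ → φ ∈ rankOneSign r lam ∧ Φ / K ≤ inner ℝ c (ψ - φ)
  sound_false : ∀ (j : ℕ) (c ψ : Tensor r) (Φ : ℝ), ψ ∈ hull r lam → 0 < Φ →
    answer j c ψ Φ = none → ∀ φ ∈ hull r lam, inner ℝ c (ψ - φ) ≤ Φ

/-- `lift j u` chooses, for each `u ∈ Proj_U(C_λ)`, a tensor in `C_λ` that projects to `u`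
(the choice may differ from call to call). -/
def IsLift {p n : ℕ} {r : Fin p → ℕ} (x : Fin n → Idx r) (lam : ℝ)
    (lift : ℕ → EuclideanSpace ℝ (Observed x) → Tensor r) : Prop :=
  ∀ j, ∀ u ∈ proj x '' hull r lam, lift j u ∈ hull r lam ∧ proj x (lift j u) = u

/-- Separation over `Proj_U(C_λ)` by exactly one call to the oracle for `C_λ`: extend the
objective by zero, lift the point, call the oracle, and project its answer. -/
def projAnswer {p n : ℕ} {r : Fin p → ℕ} (x : Fin n → Idx r) {lam K : ℝ}
    (O : WeakSeparationOracle r lam K) (lift : ℕ → EuclideanSpace ℝ (Observed x) → Tensor r)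
    (j : ℕ) (c u : EuclideanSpace ℝ (Observed x)) (Φ : ℝ) :
    Option (EuclideanSpace ℝ (Observed x)) :=
  (O.answer j (extendZero x c) (lift j u) Φ).map (proj x)

/-! ### Blended Conditional Gradients -/

/-- A state of Blended Conditional Gradients: the current iterate, its active set of vertices, the
current gap estimate, and the number of oracle calls made so far. -/
structure BCGState (E : Type*) where
  point : E
  active : Finset E
  gap : ℝ
  calls : ℕ

/-- One simplex gradient descent step from the point `u` over `conv S`, with result `u'`, `S'`.
Write `u = ∑ w_v v` as a convex combination of `S`, let `d` be the projection of the vector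
`(⟨∇f(u), v⟩)_{v ∈ S}` orthogonally to the all-ones vector, move from `u` along `-∑ d_v v` as far
as the weights stay nonnegative to reach `z`. If `f(z) ≤ f(u)` go to `z` and drop at least one
vertex; otherwise do an exact line search on the segment from `u` to `z`.
(In the algorithm the step is only taken when `d ≠ 0`.) -/
def SimplexDescent {E : Type*} [NormedAddCommGroup E] [InnerProductSpace ℝ E] [CompleteSpace E]
    (f : E → ℝ) (u : E) (S : Finset E) (u' : E) (S' : Finset E) : Prop :=
  ∃ (w d : E → ℝ) (η : ℝ) (z : E),
    (∀ v ∈ S, 0 ≤ w v) ∧ ∑ v ∈ S, w v = 1 ∧ ∑ v ∈ S, w v • v = u ∧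
    (∀ v ∈ S, d v = inner ℝ (gradient f u) v
      - (∑ v' ∈ S, inner ℝ (gradient f u) v') / (S.card : ℝ)) ∧
    IsGreatest {t : ℝ | 0 ≤ t ∧ ∀ v ∈ S, 0 ≤ w v - t * d v} η ∧
    z = u - η • ∑ v ∈ S, d v • v ∧
    ((f z ≤ f u ∧ u' = z ∧ S' ⊂ S ∧ z ∈ convexHull ℝ (S' : Set E)) ∨
      (f u < f z ∧ S' = S ∧ u' ∈ segment ℝ u z ∧ IsMinOn f (segment ℝ u z) u'))

/-- One iteration of Blended Conditional Gradients for the objective `f`; `ans j c u Φ` is the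
answer of the weak separation oracle to call number `j`. -/
inductive BCGIteration {E : Type*} [NormedAddCommGroup E] [InnerProductSpace ℝ E]
    [CompleteSpace E] (f : E → ℝ) (ans : ℕ → E → E → ℝ → Option E) :
    BCGState E → BCGState E → Prop
  /-- Two active vertices differ by at least `Φ` in the gradient: simplex descent, no call. -/
  | descent (u : E) (S : Finset E) (Φ : ℝ) (N : ℕ) (u' : E) (S' : Finset E) :
      (∃ a ∈ S, ∃ b ∈ S, Φ ≤ inner ℝ (gradient f u) (a - b)) →
      SimplexDescent f u S u' S' →
      BCGIteration f ans ⟨u, S, Φ, N⟩ ⟨u', S', Φ, N⟩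
  /-- Otherwise the oracle is called. If it answers **false**, the gap estimate is halved. -/
  | gapStep (u : E) (S : Finset E) (Φ : ℝ) (N : ℕ) :
      (∀ a ∈ S, ∀ b ∈ S, inner ℝ (gradient f u) (a - b) < Φ) →
      ans N (gradient f u) u Φ = none →
      BCGIteration f ans ⟨u, S, Φ, N⟩ ⟨u, S, Φ / 2, N + 1⟩
  /-- If it returns a vertex `v`: Frank-Wolfe step with exact line search towards `v`; the new
  active set is a minimal part of `S ∪ {v}` whose hull contains the new iterate. -/
  | frankWolfe (u : E) (S : Finset E) (Φ : ℝ) (N : ℕ) (v u' : E) (S' : Finset E) :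
      (∀ a ∈ S, ∀ b ∈ S, inner ℝ (gradient f u) (a - b) < Φ) →
      ans N (gradient f u) u Φ = some v →
      u' ∈ segment ℝ u v → IsMinOn f (segment ℝ u v) u' →
      Minimal (fun T : Finset E =>
        (T : Set E) ⊆ insert v (S : Set E) ∧ u' ∈ convexHull ℝ (T : Set E)) S' →
      BCGIteration f ans ⟨u, S, Φ, N⟩ ⟨u', S', Φ, N + 1⟩

/-- The start of the algorithm at the vertex `u₀` with initial gap estimate `Φ₀`. -/
def bcgInit {E : Type*} (u₀ : E) (Φ₀ : ℝ) : BCGState E := ⟨u₀, {u₀}, Φ₀, 0⟩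

/-- The stopping rule for tolerance `ε`: twice the gap estimate is at most `ε`. -/
def Stopped {E : Type*} (ε : ℝ) (σ : BCGState E) : Prop := 2 * σ.gap ≤ ε

/-- A step of the algorithm with tolerance `ε`: an iteration, performed unless stopped. -/
def BCGStep {E : Type*} [NormedAddCommGroup E] [InnerProductSpace ℝ E] [CompleteSpace E]
    (f : E → ℝ) (ans : ℕ → E → E → ℝ → Option E) (ε : ℝ) (σ σ' : BCGState E) : Prop :=
  ¬ Stopped ε σ ∧ BCGIteration f ans σ σ'

/-- `Φ₀` is an admissible initial gap estimate at `u₀` for minimising `f` over `P`: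
`max_{v ∈ P} ⟨∇f(u₀), u₀ - v⟩ / 2 ≤ Φ₀`. The usual choice is equality. -/
def IsInitialGap {E : Type*} [NormedAddCommGroup E] [InnerProductSpace ℝ E] [CompleteSpace E]
    (f : E → ℝ) (P : Set E) (u₀ : E) (Φ₀ : ℝ) : Prop :=
  ∀ v ∈ P, inner ℝ (gradient f u₀) (u₀ - v) / 2 ≤ Φ₀

end TensorCompletion

end

namespace TensorCompletion

/-! ### A Hoffman bound for convex weights -/

/-! The constant `C` can be uniform in `y` because only the linear part of `f` depends on `y`. Its
curvature lies between `1/n` and `1` on the observed coordinates, and the polytope spanned by the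
projected sign tensors is fixed.

Fix a polytope `conv V` and call a phase a stretch of constant gap estimate `Φ`. Every Frank-Wolfe
step in a phase lowers `f` by at least `lineDecrease B (Φ / K)`, which is linear in `Φ` for large
`Φ` and quadratic for small `Φ`. A phase that follows a halving starts where the oracle has just
answered false and the descent test has just failed, so at that point the gradient varies by `O(Φ)`
between active vertices and all of `V`. The primal gap there is then `O(Φ)` by convexity and also
`O(Φ²)` by geometric strong convexity (`QuadraticBounds.primal_gap_le`). Admissibility of `Φ₀` gives
the same bounds at the start. Hence a phase contains a bounded number `M` of Frank-Wolfe steps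
(`le_mul_lineDecrease`) and at most one false answer, while simplex descent costs no call and never
increases `f`. The number of phases is logarithmic in `Φ₀ / ε`.

Geometric strong convexity rests on a Hoffman bound (`exists_weights_near`): nearby points of a
polytope have nearby convex weights, which turns the variation over vertices into a bound on
`⟨∇f(u), u - x⟩` proportional to `‖u - x‖` (`exists_inner_sub_le`).

For tensors, the gauge ball of radius `lam` is `hull r lam`, and multilinearity reduces its
generators to sign tensors. Extension by zero is adjoint to the projection, so the oracle on tensors
serves the projected polytope. -/

open Filter Topology in
/-- Convex weights representing `x` can be chosen close to any given convex weights `α`, with a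
constant that depends on the points only. -/
theorem exists_weights_near {E : Type*} [NormedAddCommGroup E] [NormedSpace ℝ E]
    {ι : Type*} [Fintype ι] (v : ι → E) :
    ∃ κ : ℝ, 0 ≤ κ ∧ ∀ α ∈ stdSimplex ℝ ι, ∀ β ∈ stdSimplex ℝ ι,
      ∃ β' ∈ stdSimplex ℝ ι, ∑ i, β' i • v i = ∑ i, β i • v i ∧
        ∑ i, |β' i - α i| ≤ κ * ‖∑ i, β i • v i - ∑ i, α i • v i‖ := by
  classical
  let A : (ι → ℝ) → E := fun γ => ∑ i, γ i • v i
  have hA : Continuous A := by fun_prop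
  have hsub : ∀ a b, A (a - b) = A a - A b := fun a b => by simp [A, sub_smul]
  have hsm : ∀ (t : ℝ) a, A (t • a) = t • A a := fun t a => by
    simp [A, mul_smul, Finset.smul_sum]
  -- Normalised weight differences whose nonzero entries have the signs prescribed by `σ`; an entry
  -- is forced to vanish where `σ` does.
  let Q : (ι → SignType) → Set (ι → ℝ) := fun σ =>
    {k | ‖k‖ = 1 ∧ (∀ i, ((σ i : SignType) : ℝ) * |k i| = k i) ∧ ∑ i, k i = 0}
  have hQ : ∀ σ, IsCompact (Q σ) := by
    intro σ
    have hcl : IsClosed (Q σ) := by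
      have : Q σ = {k | ‖k‖ = 1} ∩ ((⋂ i, {k | ((σ i : SignType) : ℝ) * |k i| = k i}) ∩
          {k | ∑ i, k i = 0}) := by
        ext k; simp [Q]
      rw [this]
      refine (isClosed_eq (by fun_prop) (by fun_prop)).inter
        ((isClosed_iInter fun i => isClosed_eq (by fun_prop) (by fun_prop)).inter
          (isClosed_eq (by fun_prop) (by fun_prop)))
    refine (isCompact_closedBall (0 : ι → ℝ) 1).of_isClosed_subset hcl ?_
    rintro k ⟨hk, -⟩
    simp [hk]
  -- Compactness keeps `‖A k‖` away from zero on each pattern that misses the kernel of `A`. There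
  -- are finitely many patterns, so the constants can be summed.
  have hc : ∀ σ, ∃ c : ℝ, 0 ≤ c ∧ ((∀ k ∈ Q σ, A k ≠ 0) → ∀ k ∈ Q σ, 1 ≤ c * ‖A k‖) := by
    intro σ
    by_cases hne : (Q σ).Nonempty
    · obtain ⟨k₀, hk₀, hmin⟩ := (hQ σ).exists_isMinOn hne hA.norm.continuousOn
      refine ⟨‖A k₀‖⁻¹, by positivity, fun h k hk => ?_⟩
      have hpos : 0 < ‖A k₀‖ := norm_pos_iff.2 (h k₀ hk₀)
      rw [inv_mul_eq_div, one_le_div hpos]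
      exact hmin hk
    · exact ⟨0, le_rfl, fun _ k hk => absurd ⟨k, hk⟩ hne⟩
  choose c hc0 hc using hc
  refine ⟨Fintype.card ι * ∑ σ, c σ,
    mul_nonneg (by positivity) (Finset.sum_nonneg fun σ _ => hc0 σ), fun α hα β hβ => ?_⟩
  have hK : IsCompact (stdSimplex ℝ ι ∩ {b | A b = A β}) :=
    (isCompact_stdSimplex ℝ ι).inter_right (isClosed_eq hA continuous_const)
  -- Among all weights of the target point, `b` is closest to `α` in the `ℓ¹` distance.
  obtain ⟨b, ⟨hb, hbA⟩, hmin⟩ := hK.exists_isMinOn ⟨β, hβ, rfl⟩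
    (f := fun b => ∑ i, |b i - α i|) (by fun_prop)
  refine ⟨b, hb, hbA, ?_⟩
  set γ : ι → ℝ := b - α with hγ
  change ∑ i, |γ i| ≤ _ * ‖A β - A α‖
  have hAγ : A β - A α = A γ := by rw [hγ, hsub, ← hbA]
  rw [hAγ]
  by_cases hγ0 : γ = 0
  · simp only [hγ0, Pi.zero_apply, abs_zero, Finset.sum_const_zero]
    exact mul_nonneg (mul_nonneg (by positivity) (Finset.sum_nonneg fun σ _ => hc0 σ))
      (norm_nonneg _)
  have hγpos : 0 < ‖γ‖ := norm_pos_iff.2 hγ0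
  let σ : ι → SignType := fun i => SignType.sign (γ i)
  -- A kernel vector with the signs of `b - α` could be subtracted from `b` in a small amount: the
  -- point stays the same, the weights stay nonnegative, and the distance to `α` drops, against
  -- minimality.
  have hker : ∀ k ∈ Q σ, A k ≠ 0 := by
    rintro k ⟨hk1, hkσ, hks⟩ hAk
    have hev : ∀ᶠ t in 𝓝[>] (0 : ℝ), ∀ i, γ i ≠ 0 → t ≤ |γ i| := by
      rw [eventually_all]
      intro i
      by_cases hi : γ i = 0
      · simp [hi]
      · filter_upwards [Ioc_mem_nhdsGT (abs_pos.2 hi)] with t ht _ using ht.2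
    obtain ⟨t, ht, htpos⟩ := (hev.and self_mem_nhdsWithin).exists
    have htpos : 0 < t := htpos
    have hkle : ∀ i, |k i| ≤ 1 := fun i => hk1 ▸ norm_le_pi_norm k i
    have key : ∀ i, 0 ≤ b i - t * k i ∧ |γ i - t * k i| = |γ i| - t * |k i| := by
      intro i
      have hαi := hα.1 i
      have hbi := hb.1 i
      have hγi : γ i = b i - α i := rfl
      have h1 := hkσ i
      have h2 := hkle i
      have h3 := ht i
      rcases lt_trichotomy (γ i) 0 with h | h | h
      · simp only [σ, sign_neg h, SignType.coe_neg_one] at h1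
        have h3 := h3 h.ne
        rw [abs_of_neg h] at h3 ⊢
        have hk0 : k i ≤ 0 := by have := abs_nonneg (k i); linarith
        rw [abs_of_nonpos hk0] at h2 ⊢
        have : t * -k i ≤ t * 1 := mul_le_mul_of_nonneg_left h2 htpos.le
        have h5 : 0 ≤ t * -k i := mul_nonneg htpos.le (by linarith)
        refine ⟨by linarith, ?_⟩
        rw [abs_of_nonpos (by linarith)]
        ring
      · simp only [σ, h, sign_zero, SignType.coe_zero, zero_mul] at h1
        simp [← h1, hbi]
      · simp only [σ, sign_pos h, SignType.coe_one, one_mul] at h1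
        have h3 := h3 h.ne'
        rw [abs_of_pos h] at h3 ⊢
        have hk0 : 0 ≤ k i := by have := abs_nonneg (k i); linarith
        rw [abs_of_nonneg hk0] at h2 ⊢
        have : t * k i ≤ t * 1 := mul_le_mul_of_nonneg_left h2 htpos.le
        refine ⟨by linarith, ?_⟩
        rw [abs_of_nonneg (by linarith)]
    have hmem : b - t • k ∈ stdSimplex ℝ ι ∩ {b | A b = A β} := by
      refine ⟨⟨fun i => (key i).1, ?_⟩, ?_⟩
      · have := hb.2
        simp only [Pi.sub_apply, Pi.smul_apply, smul_eq_mul, Finset.sum_sub_distrib,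
          ← Finset.mul_sum, hks, this]
        ring
      · change A (b - t • k) = A β
        rw [hsub, hsm, hAk, smul_zero, sub_zero]
        exact hbA
    have hle : ∑ i, |b i - α i| ≤ ∑ i, |(b - t • k) i - α i| := hmin hmem
    have heq : ∑ i, |(b - t • k) i - α i| = ∑ i, |γ i| - t * ∑ i, |k i| := by
      rw [Finset.mul_sum, ← Finset.sum_sub_distrib]
      refine Finset.sum_congr rfl fun i _ => ?_
      rw [← (key i).2]
      congr 1
      simp only [Pi.sub_apply, Pi.smul_apply, smul_eq_mul, hγ]
      ring
    have hkpos : 0 < ∑ i, |k i| := by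
      have hk0 : k ≠ 0 := by rintro rfl; simp at hk1
      obtain ⟨i, hi⟩ := Function.ne_iff.1 hk0
      exact Finset.sum_pos' (fun i _ => abs_nonneg _) ⟨i, Finset.mem_univ i, abs_pos.2 hi⟩
    rw [heq] at hle
    have : ∑ i, |b i - α i| = ∑ i, |γ i| := rfl
    have := mul_pos htpos hkpos
    linarith
  have hmemQ : ‖γ‖⁻¹ • γ ∈ Q σ := by
    refine ⟨by rw [norm_smul, norm_inv, norm_norm, inv_mul_cancel₀ hγpos.ne'], fun i => ?_, ?_⟩
    · have : ((SignType.sign (γ i) : SignType) : ℝ) * |γ i| = γ i := sign_mul_abs _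
      simp only [Pi.smul_apply, smul_eq_mul, abs_mul, abs_inv, abs_norm, σ]
      rw [mul_left_comm, this]
    · simp only [Pi.smul_apply, smul_eq_mul, ← Finset.mul_sum, hγ, Pi.sub_apply,
        Finset.sum_sub_distrib, hb.2, hα.2, sub_self, mul_zero]
  have h1 := hc σ hker _ hmemQ
  rw [hsm, norm_smul, norm_inv, norm_norm] at h1
  have h2 : ‖γ‖ ≤ c σ * ‖A γ‖ := by
    have := mul_le_mul_of_nonneg_left h1 hγpos.le
    have e : ‖γ‖ * (c σ * (‖γ‖⁻¹ * ‖A γ‖)) = c σ * ‖A γ‖ := by field_simp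
    linarith
  have h3 : c σ ≤ ∑ σ, c σ := Finset.single_le_sum (fun σ _ => hc0 σ) (Finset.mem_univ σ)
  calc ∑ i, |γ i| ≤ ∑ _i : ι, ‖γ‖ := Finset.sum_le_sum fun i _ => norm_le_pi_norm γ i
    _ = Fintype.card ι * ‖γ‖ := by simp
    _ ≤ Fintype.card ι * ((∑ σ, c σ) * ‖A γ‖) := by
        gcongr
        exact h2.trans (mul_le_mul_of_nonneg_right h3 (norm_nonneg _))
    _ = _ := by ring

theorem sum_coe_ite_mem {E F : Type*} [DecidableEq E] [AddCommMonoid F] {S V : Finset E}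
    (hS : S ⊆ V) (φ : E → F) : ∑ v : V, (if (v : E) ∈ S then φ v else 0) = ∑ v ∈ S, φ v := by
  rw [Finset.sum_coe_sort V (fun v => if v ∈ S then φ v else 0), ← Finset.sum_filter,
    Finset.filter_mem_eq_inter, Finset.inter_eq_right.2 hS]

/-- A linear functional separates two points of a polytope by at most their distance times its
largest variation between the active vertices and all vertices. -/
theorem exists_inner_sub_le {E : Type*} [NormedAddCommGroup E] [InnerProductSpace ℝ E]
    (V : Finset E) :
    ∃ κ : ℝ, 0 ≤ κ ∧ ∀ S ⊆ V, ∀ u ∈ convexHull ℝ (S : Set E), ∀ x ∈ convexHull ℝ (V : Set E),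
      ∀ (g : E) (G : ℝ), (∀ a ∈ S, ∀ v ∈ V, inner ℝ g (a - v) ≤ G) →
        inner ℝ g (u - x) ≤ κ * G * ‖u - x‖ := by
  classical
  obtain ⟨κ, hκ, h⟩ := exists_weights_near (fun v : V => (v : E))
  refine ⟨κ, hκ, fun S hS u hu x hx g G hG => ?_⟩
  obtain ⟨w, hw0, hw1, hwu⟩ := Finset.mem_convexHull'.1 hu
  obtain ⟨w', hw'0, hw'1, hwx⟩ := Finset.mem_convexHull'.1 hx
  obtain ⟨a₀, ha₀⟩ : S.Nonempty := by
    rw [Finset.nonempty_iff_ne_empty]; rintro rfl; simp at hw1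
  have hG0 : 0 ≤ G := by simpa using hG a₀ ha₀ a₀ (hS ha₀)
  let α : V → ℝ := fun v => if (v : E) ∈ S then w v else 0
  have hα : α ∈ stdSimplex ℝ V := by
    refine ⟨fun v => ?_, (sum_coe_ite_mem hS w).trans hw1⟩
    by_cases hv : (v : E) ∈ S
    · simp [α, hv, hw0]
    · simp [α, hv]
  have hαu : ∑ v : V, α v • (v : E) = u := by
    rw [← hwu, ← sum_coe_ite_mem hS]
    refine Finset.sum_congr rfl fun v _ => ?_
    simp only [α]
    split_ifs <;> simp
  obtain ⟨β, hβ, hβx, hle⟩ := h α hα (fun v => w' v)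
    ⟨fun v => hw'0 v v.2, by rw [← hw'1, Finset.sum_coe_sort V w']⟩
  have hx' : ∑ v : V, w' v • (v : E) = x := by
    rw [← hwx, Finset.sum_coe_sort V fun v => w' v • v]
  rw [hx'] at hβx hle
  rw [hαu, norm_sub_rev] at hle
  have hsum0 : ∑ v : V, (α v - β v) = 0 := by
    rw [Finset.sum_sub_distrib, hα.2, hβ.2, sub_self]
  have heq : inner ℝ g (u - x) = ∑ v : V, (α v - β v) * inner ℝ g ((v : E) - a₀) := by
    -- The weight differences sum to zero, so the base point `a₀` may be subtracted for free.
    have : u - x = ∑ v : V, (α v - β v) • ((v : E) - a₀) := by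
      simp only [smul_sub, Finset.sum_sub_distrib, ← Finset.sum_smul, hsum0, zero_smul, sub_zero]
      rw [← hαu, ← hβx, ← Finset.sum_sub_distrib]
      simp only [sub_smul]
    rw [this, inner_sum]
    simp only [inner_smul_right]
  -- Where `α v > β v` the vertex is active and is compared with `a₀` directly; elsewhere `a₀` is
  -- the active vertex of the comparison.
  have hterm : ∀ v : V, (α v - β v) * inner ℝ g ((v : E) - a₀) ≤ |β v - α v| * G := by
    intro v
    rcases le_or_gt (α v) (β v) with hv | hv
    · have := hG a₀ ha₀ v v.2
      rw [abs_of_nonneg (by linarith), ← neg_sub a₀ (v : E), inner_neg_right]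
      nlinarith
    · have hvS : (v : E) ∈ S := by
        by_contra hvS
        have : α v = 0 := by simp [α, hvS]
        linarith [hβ.1 v]
      have := hG v hvS a₀ (hS ha₀)
      rw [abs_of_neg (by linarith)]
      nlinarith
  calc inner ℝ g (u - x) ≤ ∑ v : V, |β v - α v| * G := heq ▸ Finset.sum_le_sum fun v _ => hterm v
    _ = (∑ v : V, |β v - α v|) * G := by rw [Finset.sum_mul]
    _ ≤ κ * ‖u - x‖ * G := mul_le_mul_of_nonneg_right hle hG0
    _ = κ * G * ‖u - x‖ := by ring

/-! ### Convergence of Blended Conditional Gradients over a polytope -/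

section BCG

variable {E : Type*} [NormedAddCommGroup E] [InnerProductSpace ℝ E]

theorem exists_isMinOn_segment {f : E → ℝ} (hf : Continuous f) (u z : E) :
    ∃ u' ∈ segment ℝ u z, IsMinOn f (segment ℝ u z) u' := by
  refine IsCompact.exists_isMinOn ?_ ⟨u, left_mem_segment ℝ u z⟩ hf.continuousOn
  rw [segment_eq_image']
  exact isCompact_Icc.image (by fun_prop)

/-- The deviations of a function from its mean sum to zero. -/
theorem sum_sub_mean_eq_zero {ι : Type*} (S : Finset ι) (φ d : ι → ℝ) (hS : S.Nonempty)
    (hd : ∀ v ∈ S, d v = φ v - (∑ v' ∈ S, φ v') / (S.card : ℝ)) : ∑ v ∈ S, d v = 0 := by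
  rw [Finset.sum_congr rfl hd, Finset.sum_sub_distrib, Finset.sum_const, nsmul_eq_mul]
  have : (S.card : ℝ) ≠ 0 := by exact_mod_cast hS.card_pos.ne'
  field_simp
  ring

/-- The active vertices belong to `V` and their convex hull contains the iterate. -/
def BCGState.Valid (V : Finset E) (σ : BCGState E) : Prop :=
  σ.active ⊆ V ∧ σ.point ∈ convexHull ℝ (σ.active : Set E)

theorem BCGState.Valid.point_mem {V : Finset E} {σ : BCGState E} (h : σ.Valid V) :
    σ.point ∈ convexHull ℝ (V : Set E) :=
  convexHull_mono (Finset.coe_subset.2 h.1) h.2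

theorem norm_le_of_mem_convexHull {V : Finset E} {R : ℝ} (hR : ∀ v ∈ V, ‖v‖ ≤ R) {u : E}
    (hu : u ∈ convexHull ℝ (V : Set E)) : ‖u‖ ≤ R := by
  have : convexHull ℝ (V : Set E) ⊆ Metric.closedBall 0 R :=
    convexHull_min (fun v hv => by simpa using hR v hv) (convex_closedBall 0 R)
  simpa using this hu

variable [CompleteSpace E]

/-- `f` lies between two quadratic models with curvatures `m` and `L` at every point. -/
structure QuadraticBounds (f : E → ℝ) (m L : ℝ) : Prop where
  continuous : Continuous f
  lower : ∀ u w, f u + inner ℝ (gradient f u) (w - u) + m * ‖w - u‖ ^ 2 ≤ f w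
  upper : ∀ u w, f w ≤ f u + inner ℝ (gradient f u) (w - u) + L * ‖w - u‖ ^ 2

/-- `ans` is a weak separation oracle over `conv V` at the gradients of `f`. -/
structure IsSeparation (f : E → ℝ) (ans : ℕ → E → E → ℝ → Option E) (V : Finset E) (K : ℝ) :
    Prop where
  vertex : ∀ j, ∀ u ∈ convexHull ℝ (V : Set E), ∀ Φ v, 0 < Φ →
    ans j (gradient f u) u Φ = some v → v ∈ V ∧ Φ / K ≤ inner ℝ (gradient f u) (u - v)
  gap : ∀ j, ∀ u ∈ convexHull ℝ (V : Set E), ∀ Φ, 0 < Φ → ans j (gradient f u) u Φ = none →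
    ∀ v ∈ convexHull ℝ (V : Set E), inner ℝ (gradient f u) (u - v) ≤ Φ

theorem QuadraticBounds.le_of_isMinOn_segment {f : E → ℝ} {m L : ℝ} (hf : QuadraticBounds f m L)
    {u z u' : E} (hmin : IsMinOn f (segment ℝ u z) u') {t : ℝ} (ht : t ∈ Set.Icc (0 : ℝ) 1) :
    f u' ≤ f u + t * inner ℝ (gradient f u) (z - u) + t ^ 2 * (L * ‖z - u‖ ^ 2) := by
  have hmem : u + t • (z - u) ∈ segment ℝ u z := by
    rw [segment_eq_image']
    exact ⟨t, ht, rfl⟩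
  have h1 : f u' ≤ f (u + t • (z - u)) := hmin hmem
  have h2 := hf.upper u (u + t • (z - u))
  rw [add_sub_cancel_left, inner_smul_right, norm_smul, mul_pow, Real.norm_eq_abs, sq_abs] at h2
  linarith

/-- The decrease guaranteed by an exact line search whose slope is at least `g`, for curvature at
most `B`. -/
noncomputable def lineDecrease (B g : ℝ) : ℝ := min (g / 2) (g ^ 2 / (4 * B))

theorem lineDecrease_pos {B g : ℝ} (hB : 0 < B) (hg : 0 < g) : 0 < lineDecrease B g :=
  lt_min (by positivity) (by positivity)

theorem lineDecrease_mono {B g g' : ℝ} (hB : 0 < B) (hg : 0 ≤ g) (h : g ≤ g') :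
    lineDecrease B g ≤ lineDecrease B g' := by
  unfold lineDecrease
  gcongr

theorem QuadraticBounds.lineSearch_decrease {f : E → ℝ} {m L B g : ℝ}
    (hf : QuadraticBounds f m L) {u z u' : E} (hmin : IsMinOn f (segment ℝ u z) u')
    (hB : 0 < B) (hg : 0 < g) (hLB : L * ‖z - u‖ ^ 2 ≤ B)
    (hslope : g ≤ inner ℝ (gradient f u) (u - z)) :
    f u' ≤ f u - lineDecrease B g := by
  have hs : inner ℝ (gradient f u) (z - u) ≤ -g := by
    rw [← neg_sub, inner_neg_right]; linarith
  have key : ∀ t ∈ Set.Icc (0 : ℝ) 1, f u' ≤ f u - t * g + t ^ 2 * B := by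
    intro t ht
    have h := hf.le_of_isMinOn_segment hmin ht
    have h1 := mul_le_mul_of_nonneg_left hs ht.1
    have h2 := mul_le_mul_of_nonneg_left hLB (sq_nonneg t)
    linarith
  -- The quadratic model is minimised at `t = g / (2B)`; if this is at least `1`, the full step is
  -- taken.
  rcases le_total (2 * B) g with h | h
  · have h1 := key 1 ⟨zero_le_one, le_rfl⟩
    have h2 : lineDecrease B g ≤ g / 2 := min_le_left _ _
    linarith
  · have h1 := key (g / (2 * B)) ⟨by positivity, (div_le_one (by positivity)).2 h⟩
    have h2 : lineDecrease B g ≤ g ^ 2 / (4 * B) := min_le_right _ _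
    have e : f u - g / (2 * B) * g + (g / (2 * B)) ^ 2 * B = f u - g ^ 2 / (4 * B) := by
      field_simp
      ring
    linarith

/-! #### Simplex descent steps -/

/-- Either a vertex is lost without increasing `f`, or overshooting at `z` shows that the step is
long enough for the line search to reach the minimiser of the quadratic model, which yields a
decrease of order `Φ²`. -/
theorem SimplexDescent.spec {f : E → ℝ} {m L R B Φ : ℝ} (hf : QuadraticBounds f m L)
    {V S S' : Finset E} {u u' : E} (hSV : S ⊆ V) (hR : ∀ v ∈ V, ‖v‖ ≤ R) (hL : 0 ≤ L)
    (hB : 0 < B) (hLB : L * (R ^ 2 * V.card) ≤ B) (hΦ : 0 < Φ)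
    (hab : ∃ a ∈ S, ∃ b ∈ S, Φ ≤ inner ℝ (gradient f u) (a - b))
    (h : SimplexDescent f u S u' S') :
    S' ⊆ S ∧ u' ∈ convexHull ℝ (S' : Set E) ∧
      ((f u' ≤ f u ∧ S'.card < S.card) ∨
        (f u' ≤ f u - Φ ^ 2 / (16 * B) ∧ S'.card ≤ S.card)) := by
  obtain ⟨w, d, η, z, hw0, hw1, hwu, hd, hη, hz, h⟩ := h
  rcases h with ⟨hle, rfl, hss, hconv⟩ | ⟨hlt, rfl, hseg, hmin⟩
  · exact ⟨hss.1, hconv, Or.inl ⟨hle, Finset.card_lt_card hss⟩⟩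
  obtain ⟨a, ha, b, hb, hab⟩ := hab
  have hd0 : ∑ v ∈ S', d v = 0 := sum_sub_mean_eq_zero S' _ d ⟨a, ha⟩ hd
  refine ⟨subset_rfl, ?_, Or.inr ⟨?_, le_rfl⟩⟩
  · have hu : u ∈ convexHull ℝ (S' : Set E) := Finset.mem_convexHull'.2 ⟨w, hw0, hw1, hwu⟩
    have hz' : z ∈ convexHull ℝ (S' : Set E) := by
      refine Finset.mem_convexHull'.2 ⟨fun v => w v - η * d v, hη.1.2, ?_, ?_⟩
      · rw [Finset.sum_sub_distrib, hw1, ← Finset.mul_sum, hd0, mul_zero, sub_zero]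
      · simp only [sub_smul, Finset.sum_sub_distrib, hwu, mul_smul, ← Finset.smul_sum, hz]
    exact (convex_convexHull ℝ _).segment_subset hu hz' hseg
  set D : E := ∑ v ∈ S', d v • v with hD
  set s : ℝ := ∑ v ∈ S', d v ^ 2 with hs
  have hinner : inner ℝ (gradient f u) D = s := by
    set c := (∑ v' ∈ S', inner ℝ (gradient f u) v') / (S'.card : ℝ) with hc
    have : ∀ v ∈ S', inner ℝ (gradient f u) (d v • v) = d v ^ 2 + d v * c := by
      intro v hv
      rw [inner_smul_right]
      have := hd v hv
      have e : inner ℝ (gradient f u) v = d v + c := by linarith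
      rw [e]; ring
    rw [hD, inner_sum, Finset.sum_congr rfl this, Finset.sum_add_distrib, ← Finset.sum_mul, hd0,
      zero_mul, add_zero]
  -- From `Φ ≤ d a - d b` follows `Φ² ≤ 2 (d a² + d b²)`, and each square is at most `s`.
  have hsΦ : Φ ^ 2 / 4 ≤ s := by
    have h1 : d a ^ 2 ≤ s := Finset.single_le_sum (f := fun v => d v ^ 2)
      (fun v _ => sq_nonneg _) ha
    have h2 : d b ^ 2 ≤ s := Finset.single_le_sum (f := fun v => d v ^ 2)
      (fun v _ => sq_nonneg _) hb
    have h3 : Φ ≤ d a - d b := by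
      rw [hd a ha, hd b hb]
      rw [inner_sub_right] at hab
      linarith
    nlinarith [sq_nonneg (d a + d b)]
  have hspos : 0 < s := lt_of_lt_of_le (by positivity) hsΦ
  have hDB : L * ‖D‖ ^ 2 ≤ B * s := by
    have h1 : ‖D‖ ≤ ∑ v ∈ S', |d v| * R := by
      refine (norm_sum_le _ _).trans (Finset.sum_le_sum fun v hv => ?_)
      rw [norm_smul, Real.norm_eq_abs]
      exact mul_le_mul_of_nonneg_left (hR v (hSV hv)) (abs_nonneg _)
    rw [← Finset.sum_mul] at h1
    have h2 : (∑ v ∈ S', |d v|) ^ 2 ≤ S'.card * s := by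
      have := sq_sum_le_card_mul_sum_sq (s := S') (f := fun v => |d v|)
      simpa [sq_abs] using this
    have h3 : (S'.card : ℝ) ≤ V.card := by exact_mod_cast Finset.card_le_card hSV
    have h4 : ‖D‖ ^ 2 ≤ (R ^ 2 * V.card) * s := by
      calc ‖D‖ ^ 2 ≤ ((∑ v ∈ S', |d v|) * R) ^ 2 := by gcongr
        _ = R ^ 2 * (∑ v ∈ S', |d v|) ^ 2 := by ring
        _ ≤ R ^ 2 * (S'.card * s) := by gcongr
        _ ≤ R ^ 2 * (V.card * s) := by gcongr
        _ = _ := by ring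
    calc L * ‖D‖ ^ 2 ≤ L * ((R ^ 2 * V.card) * s) := by gcongr
      _ = L * (R ^ 2 * V.card) * s := by ring
      _ ≤ B * s := by gcongr
  have hzu : z - u = -(η • D) := by rw [hz]; abel
  have hinz : inner ℝ (gradient f u) (z - u) = -(η * s) := by
    rw [hzu, inner_neg_right, inner_smul_right, hinner]
  have hnz : ‖z - u‖ ^ 2 = η ^ 2 * ‖D‖ ^ 2 := by
    rw [hzu, norm_neg, norm_smul, mul_pow, Real.norm_eq_abs, sq_abs]
  have hη0 : 0 ≤ η := hη.1.1
  -- Here `f u < f z` is used: the upper model gives `0 < -η s + η² B s`.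
  have hηB : 1 < η * B := by
    have h1 := hf.upper u z
    rw [hinz, hnz] at h1
    have h2 : η ^ 2 * (L * ‖D‖ ^ 2) ≤ η ^ 2 * (B * s) := by gcongr
    have h3 : 0 < η * s * (η * B - 1) := by nlinarith
    have h4 := pos_of_mul_pos_right h3 (by positivity)
    linarith
  have hηpos : 0 < η := by
    rcases hη0.eq_or_lt with h | h
    · rw [← h] at hηB; simp at hηB; linarith
    · exact h
  -- This `t` minimises `-t η s + t² η² B s`, with value `-s / (4B)`.
  have ht : 1 / (2 * B * η) ∈ Set.Icc (0 : ℝ) 1 := by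
    refine ⟨by positivity, (div_le_one (by positivity)).2 ?_⟩
    nlinarith
  have h1 := hf.le_of_isMinOn_segment hmin ht
  rw [hinz, hnz] at h1
  have h2 : (1 / (2 * B * η)) ^ 2 * (L * (η ^ 2 * ‖D‖ ^ 2)) ≤
      (1 / (2 * B * η)) ^ 2 * (η ^ 2 * (B * s)) := by
    have : L * (η ^ 2 * ‖D‖ ^ 2) = η ^ 2 * (L * ‖D‖ ^ 2) := by ring
    rw [this]
    gcongr
  have e : f u + 1 / (2 * B * η) * -(η * s) + (1 / (2 * B * η)) ^ 2 * (η ^ 2 * (B * s))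
      = f u - s / (4 * B) := by
    field_simp
    ring
  have h3 : Φ ^ 2 / (16 * B) ≤ s / (4 * B) := by
    rw [div_le_div_iff₀ (by positivity) (by positivity)]
    nlinarith
  linarith

/-- The deviations `d` sum to zero and are not all zero, so some `d v` is positive and the step
length is finite. A ratio test finds the first weight to vanish; its vertex can be dropped at `z`.
-/
theorem exists_simplexDescent {f : E → ℝ} (hf : Continuous f) {S : Finset E} {u : E}
    (hu : u ∈ convexHull ℝ (S : Set E)) {Φ : ℝ} (hΦ : 0 < Φ)
    (hab : ∃ a ∈ S, ∃ b ∈ S, Φ ≤ inner ℝ (gradient f u) (a - b)) :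
    ∃ u' S', SimplexDescent f u S u' S' := by
  classical
  obtain ⟨w, hw0, hw1, hwu⟩ := Finset.mem_convexHull'.1 hu
  obtain ⟨a, ha, b, hb, hab⟩ := hab
  let d : E → ℝ := fun v => inner ℝ (gradient f u) v
      - (∑ v' ∈ S, inner ℝ (gradient f u) v') / (S.card : ℝ)
  have hd0 : ∑ v ∈ S, d v = 0 := sum_sub_mean_eq_zero S _ d ⟨a, ha⟩ fun v _ => rfl
  obtain ⟨c, hc, hdc⟩ : ∃ c ∈ S, 0 < d c := by
    by_contra! hneg
    have h0 := (Finset.sum_eq_zero_iff_of_nonpos hneg).1 hd0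
    have h1 : d a - d b = inner ℝ (gradient f u) (a - b) := by
      simp only [d]; rw [inner_sub_right]; ring
    rw [h0 a ha, h0 b hb] at h1
    linarith
  obtain ⟨v₀, hv₀, hmin⟩ := (S.filter fun v => 0 < d v).exists_min_image (fun v => w v / d v)
    ⟨c, by simp [hc, hdc]⟩
  rw [Finset.mem_filter] at hv₀
  set η := w v₀ / d v₀ with hη
  have hη0 : 0 ≤ η := div_nonneg (hw0 _ hv₀.1) hv₀.2.le
  have hnonneg : ∀ v ∈ S, 0 ≤ w v - η * d v := by
    intro v hv
    rcases le_or_gt (d v) 0 with h | h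
    · have := hw0 v hv
      nlinarith
    · have := hmin v (by simp [hv, h])
      rw [le_div_iff₀ h] at this
      linarith
  have hgreat : IsGreatest {t : ℝ | 0 ≤ t ∧ ∀ v ∈ S, 0 ≤ w v - t * d v} η := by
    refine ⟨⟨hη0, hnonneg⟩, fun t ht => ?_⟩
    rw [hη, le_div_iff₀ hv₀.2]
    linarith [ht.2 v₀ hv₀.1]
  set z := u - η • ∑ v ∈ S, d v • v with hz
  rcases le_or_gt (f z) (f u) with hle | hlt
  · refine ⟨z, S.erase v₀, w, d, η, z, hw0, hw1, hwu, fun v _ => rfl, hgreat, hz,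
      Or.inl ⟨hle, rfl, Finset.erase_ssubset hv₀.1, ?_⟩⟩
    have hzero : w v₀ - η * d v₀ = 0 := by
      rw [hη, div_mul_cancel₀ _ hv₀.2.ne', sub_self]
    refine Finset.mem_convexHull'.2 ⟨fun v => w v - η * d v,
      fun v hv => hnonneg v (Finset.mem_of_mem_erase hv), ?_, ?_⟩
    · rw [Finset.sum_erase (f := fun v => w v - η * d v) _ hzero, Finset.sum_sub_distrib, hw1, ← Finset.mul_sum, hd0, mul_zero,
        sub_zero]
    · rw [Finset.sum_erase (f := fun v => (w v - η * d v) • v) _ (by simp only [hzero, zero_smul])]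
      simp only [sub_smul, Finset.sum_sub_distrib, hwu, mul_smul, ← Finset.smul_sum, hz]
  · obtain ⟨u', hu', hmin'⟩ := exists_isMinOn_segment hf u z
    exact ⟨u', S, w, d, η, z, hw0, hw1, hwu, fun v _ => rfl, hgreat, hz,
      Or.inr ⟨hlt, rfl, hu', hmin'⟩⟩

/-! #### Iterations -/

/-- The four possible effects of an iteration. -/
theorem BCGIteration.spec {f : E → ℝ} {ans : ℕ → E → E → ℝ → Option E} {m L R B K : ℝ}
    {V : Finset E} (hf : QuadraticBounds f m L) (hans : IsSeparation f ans V K)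
    (hR : ∀ v ∈ V, ‖v‖ ≤ R) (hL : 0 ≤ L) (hB : 0 < B) (hLB : L * (R ^ 2 * V.card) ≤ B)
    (hLB' : L * (2 * R) ^ 2 ≤ B) (hK : 0 < K)
    {σ σ' : BCGState E} (hσ : σ.Valid V) (hgap : 0 < σ.gap) (h : BCGIteration f ans σ σ') :
    σ'.Valid V ∧
      ((σ'.gap = σ.gap ∧ σ'.calls = σ.calls ∧
          ((f σ'.point ≤ f σ.point ∧ σ'.active.card < σ.active.card) ∨
            (f σ'.point ≤ f σ.point - σ.gap ^ 2 / (16 * B) ∧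
              σ'.active.card ≤ σ.active.card))) ∨
        (σ'.gap = σ.gap ∧ σ'.calls = σ.calls + 1 ∧
          f σ'.point ≤ f σ.point - lineDecrease B (σ.gap / K) ∧
          σ'.active.card ≤ σ.active.card + 1) ∨
        (σ'.gap = σ.gap / 2 ∧ σ'.calls = σ.calls + 1 ∧ σ'.point = σ.point ∧
          σ'.active = σ.active ∧
          (∀ a ∈ σ.active, ∀ b ∈ σ.active,
            inner ℝ (gradient f σ.point) (a - b) ≤ σ.gap) ∧
          ∀ x ∈ convexHull ℝ (V : Set E), inner ℝ (gradient f σ.point) (σ.point - x) ≤ σ.gap)) := by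
  classical
  have huV := hσ.point_mem
  cases h with
  | descent u S Φ N u' S' hab hd =>
    obtain ⟨h1, h2, h3⟩ := hd.spec hf hσ.1 hR hL hB hLB hgap hab
    exact ⟨⟨h1.trans hσ.1, h2⟩, Or.inl ⟨rfl, rfl, h3⟩⟩
  | gapStep u S Φ N hab hnone =>
    exact ⟨hσ, Or.inr (Or.inr ⟨rfl, rfl, rfl, rfl, fun a ha b hb => (hab a ha b hb).le,
      hans.gap N u huV Φ hgap hnone⟩)⟩
  | frankWolfe u S Φ N v u' S' hab hsome hseg hmin hS' =>
    obtain ⟨hvV, hslope⟩ := hans.vertex N u huV Φ v hgap hsome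
    have hsub : S' ⊆ insert v S := by
      rw [← Finset.coe_subset, Finset.coe_insert]
      exact hS'.prop.1
    refine ⟨⟨hsub.trans (Finset.insert_subset hvV hσ.1), hS'.prop.2⟩,
      Or.inr (Or.inl ⟨rfl, rfl, ?_, (Finset.card_le_card hsub).trans (Finset.card_insert_le _ _)⟩)⟩
    refine hf.lineSearch_decrease hmin hB (div_pos hgap hK) ?_ hslope
    have h1 : ‖v - u‖ ≤ 2 * R :=
      (norm_sub_le _ _).trans (by
        have := hR v hvV
        have := norm_le_of_mem_convexHull hR huV
        linarith)
    refine le_trans ?_ hLB'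
    gcongr

theorem exists_bcgIteration {f : E → ℝ} {ans : ℕ → E → E → ℝ → Option E} {V : Finset E}
    (hf : Continuous f) {σ : BCGState E} (hσ : σ.Valid V) (hgap : 0 < σ.gap) :
    ∃ σ', BCGIteration f ans σ σ' := by
  classical
  obtain ⟨u, S, Φ, N⟩ := σ
  by_cases hab : ∃ a ∈ S, ∃ b ∈ S, Φ ≤ inner ℝ (gradient f u) (a - b)
  · obtain ⟨u', S', h⟩ := exists_simplexDescent hf hσ.2 hgap hab
    exact ⟨_, .descent u S Φ N u' S' hab h⟩
  push Not at hab
  cases hans : ans N (gradient f u) u Φ with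
  | none => exact ⟨_, .gapStep u S Φ N hab hans⟩
  | some v =>
    obtain ⟨u', hu', hmin⟩ := exists_isMinOn_segment hf u v
    have hmem : u' ∈ convexHull ℝ ((insert v S : Finset E) : Set E) := by
      refine (convex_convexHull ℝ _).segment_subset ?_ ?_ hu'
      · exact convexHull_mono (by simp) hσ.2
      · exact subset_convexHull ℝ _ (by simp)
    -- The set `insert v S` is itself admissible, so a minimal admissible subset exists by
    -- finiteness.
    obtain ⟨S', -, hS'⟩ := exists_minimal_le_of_wellFoundedLT
      (fun T : Finset E => (T : Set E) ⊆ insert v (S : Set E) ∧ u' ∈ convexHull ℝ (T : Set E))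
      (insert v S) ⟨by simp, hmem⟩
    exact ⟨_, .frankWolfe u S Φ N v u' S' hab hans hu' hmin hS'⟩

end BCG

/-! ### Counting oracle calls phase by phase, and termination -/

section BCG

variable {E : Type*} [NormedAddCommGroup E] [InnerProductSpace ℝ E]

/-- Bounds on the gap and on the variation of the gradient over the active set bound its
variation between active vertices and vertices. -/
theorem BCGState.Valid.inner_sub_le {V : Finset E} {σ : BCGState E} (hσ : σ.Valid V) {g : E}
    {Φ₁ Φ₂ : ℝ} (hact : ∀ a ∈ σ.active, ∀ b ∈ σ.active, inner ℝ g (a - b) ≤ Φ₁)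
    (hgap : ∀ x ∈ convexHull ℝ (V : Set E), inner ℝ g (σ.point - x) ≤ Φ₂) :
    ∀ a ∈ σ.active, ∀ v ∈ V, inner ℝ g (a - v) ≤ Φ₁ + Φ₂ := by
  intro a ha v hv
  have h1 : inner ℝ g (a - σ.point) ≤ Φ₁ := by
    have hsub : convexHull ℝ (σ.active : Set E) ⊆ {w | inner ℝ g a - Φ₁ ≤ innerSL ℝ g w} := by
      refine convexHull_min (fun b hb => ?_)
        (convex_halfSpace_ge (innerSL ℝ g).toLinearMap.isLinear _)
      have := hact a ha b hb
      rw [inner_sub_right] at this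
      simp only [Set.mem_ofPred_eq, innerSL_apply_apply]
      linarith
    have := hsub hσ.2
    simp only [Set.mem_ofPred_eq, innerSL_apply_apply] at this
    rw [inner_sub_right]
    linarith
  have h2 := hgap v (subset_convexHull ℝ _ hv)
  have e : a - v = (a - σ.point) + (σ.point - v) := by abel
  rw [e, inner_add_right]
  linarith

/-- At the start of a phase the primal gap is at most a constant number of Frank-Wolfe decreases. -/
theorem le_mul_lineDecrease {B K c h Φ : ℝ} (hB : 0 < B) (hK : 0 < K) (hc : 0 ≤ c) (hΦ : 0 ≤ Φ)
    (h1 : h ≤ 2 * Φ) (h2 : h ≤ c * Φ ^ 2) :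
    h ≤ (4 * K + 4 * B * K ^ 2 * c) * lineDecrease B (Φ / K) := by
  unfold lineDecrease
  -- In the linear regime `4 * K` decreases amount to `2Φ`; in the quadratic regime `4 * B * K ^ 2 *
  -- c` decreases amount to `c Φ²`.
  rcases min_cases (Φ / K / 2) ((Φ / K) ^ 2 / (4 * B)) with ⟨he, -⟩ | ⟨he, -⟩ <;> rw [he]
  · have e : (4 * K + 4 * B * K ^ 2 * c) * (Φ / K / 2) = 2 * Φ + 2 * B * K * c * Φ := by
      field_simp
      ring
    rw [e]
    have : 0 ≤ 2 * B * K * c * Φ := by positivity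
    linarith
  · have e : (4 * K + 4 * B * K ^ 2 * c) * ((Φ / K) ^ 2 / (4 * B)) = Φ ^ 2 / (K * B) + c * Φ ^ 2 := by
      field_simp
    rw [e]
    have : 0 ≤ Φ ^ 2 / (K * B) := by positivity
    linarith

/-- The number of halvings of the gap estimate is logarithmic. -/
theorem natCast_le_log_of_lt_div_two_pow {Φ₀ ε : ℝ} (hΦ : 0 ≤ Φ₀) (hε : 0 < ε) {j : ℕ}
    (h : j = 0 ∨ ε / 4 < Φ₀ / 2 ^ j) : (j : ℝ) ≤ 2 + 2 * Real.log (1 + Φ₀ / ε) := by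
  have hlog : 0 ≤ Real.log (1 + Φ₀ / ε) := Real.log_nonneg (by
    have : 0 ≤ Φ₀ / ε := by positivity
    linarith)
  rcases h with rfl | h
  · simp; linarith
  rw [lt_div_iff₀ (by positivity)] at h
  have h1 : (2 : ℝ) ^ j ≤ 2 ^ 2 * (1 + Φ₀ / ε) := by
    have : Φ₀ = Φ₀ / ε * ε := by field_simp
    have : (2 : ℝ) ^ j ≤ 4 * (Φ₀ / ε) := by
      rw [← mul_div_assoc, le_div_iff₀ hε]
      linarith
    linarith
  have h2 := Real.log_le_log (by positivity) h1
  have hpos : 0 < 1 + Φ₀ / ε := by positivity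
  rw [Real.log_pow, Real.log_mul (by norm_num) hpos.ne', Real.log_pow] at h2
  -- Only `log 2 > 1/2` matters; it accounts for the factor `2` before the logarithm.
  have h3 := Real.log_two_gt_d9
  push_cast at h2
  by_contra! hlt
  have h4 : 2 * Real.log (1 + Φ₀ / ε) * Real.log 2 < (j - 2) * Real.log 2 :=
    mul_lt_mul_of_pos_right (by linarith) (by linarith)
  nlinarith

variable [CompleteSpace E]

/-- Geometric strong convexity: the primal gap at `u` is at most quadratic in the variation of the
gradient between active vertices and vertices. -/
theorem QuadraticBounds.primal_gap_le {f : E → ℝ} {m L κ G : ℝ} (hf : QuadraticBounds f m L)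
    (hm : 0 < m) {u x : E} (h : inner ℝ (gradient f u) (u - x) ≤ κ * G * ‖u - x‖) :
    f u - f x ≤ κ ^ 2 * G ^ 2 / (4 * m) := by
  have h1 := hf.lower u x
  rw [← neg_sub u x, inner_neg_right, norm_neg] at h1
  -- What remains is the maximum of `κ G d - m d²` over `d = ‖u - x‖`, found by completing the
  -- square.
  rw [le_div_iff₀ (by positivity)]
  nlinarith [sq_nonneg (κ * G - 2 * m * ‖u - x‖)]

/-- The invariant of an execution: after `j` halvings of the gap estimate, each phase has made at
most `M + 1` oracle calls, the decreases yet to come being charged to the primal gap. -/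
def BCGState.Invariant (f : E → ℝ) (V : Finset E) (B K M Φ₀ ε : ℝ) (σ : BCGState E) : Prop :=
  σ.Valid V ∧ ∃ j : ℕ, σ.gap = Φ₀ / 2 ^ j ∧ (j = 0 ∨ ε / 4 < σ.gap) ∧
    (∀ x ∈ convexHull ℝ (V : Set E), f σ.point - f x ≤ 2 * σ.gap) ∧
    (σ.calls : ℝ) ≤ (M + 1) * (j + 1) ∧
    ∀ x ∈ convexHull ℝ (V : Set E),
      σ.calls * lineDecrease B (σ.gap / K) + (f σ.point - f x) ≤
        (M + 1) * (j + 1) * lineDecrease B (σ.gap / K)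

variable {f : E → ℝ} {ans : ℕ → E → E → ℝ → Option E} {m L R B K κ ε Φ₀ : ℝ} {V : Finset E}

/-- The invariant is preserved by the steps of the algorithm. -/
theorem BCGState.Invariant.step (hf : QuadraticBounds f m L) (hans : IsSeparation f ans V K)
    (hR : ∀ v ∈ V, ‖v‖ ≤ R) (hm : 0 < m) (hL : 0 ≤ L) (hB : 0 < B)
    (hLB : L * (R ^ 2 * V.card) ≤ B) (hLB' : L * (2 * R) ^ 2 ≤ B) (hK : 0 < K)
    (hκ : ∀ S ⊆ V, ∀ u ∈ convexHull ℝ (S : Set E), ∀ x ∈ convexHull ℝ (V : Set E),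
      ∀ (g : E) (G : ℝ), (∀ a ∈ S, ∀ v ∈ V, inner ℝ g (a - v) ≤ G) →
        inner ℝ g (u - x) ≤ κ * G * ‖u - x‖) (hε : 0 < ε) {σ σ' : BCGState E}
    (hσ : σ.Invariant f V B K (4 * K + 4 * B * K ^ 2 * (4 * κ ^ 2 / m)) Φ₀ ε)
    (h : BCGStep f ans ε σ σ') :
    σ'.Invariant f V B K (4 * K + 4 * B * K ^ 2 * (4 * κ ^ 2 / m)) Φ₀ ε := by
  set M := 4 * K + 4 * B * K ^ 2 * (4 * κ ^ 2 / m) with hM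
  have hM0 : 0 ≤ M := by positivity
  obtain ⟨hval, j, hj, hj', hprim, hcalls, hpot⟩ := hσ
  obtain ⟨hns, hit⟩ := h
  have hgap2 : ε / 2 < σ.gap := by
    rw [Stopped, not_le] at hns; linarith
  have hgap : 0 < σ.gap := by linarith
  obtain ⟨hval', hcase⟩ := hit.spec hf hans hR hL hB hLB hLB' hK hval hgap
  have hδ : 0 < lineDecrease B (σ.gap / K) := lineDecrease_pos hB (by positivity)
  refine ⟨hval', ?_⟩
  rcases hcase with ⟨hg, hc, hd⟩ | ⟨hg, hc, hd, -⟩ | ⟨hg, hc, hp, ha, hact, hdual⟩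
  · have hle : f σ'.point ≤ f σ.point := by
      rcases hd with hd | hd
      · exact hd.1
      · have : 0 ≤ σ.gap ^ 2 / (16 * B) := by positivity
        linarith [hd.1]
    refine ⟨j, by rw [hg, hj], by rwa [hg], fun x hx => ?_, by rwa [hc], fun x hx => ?_⟩
    · rw [hg]; linarith [hprim x hx]
    · rw [hg, hc]; linarith [hpot x hx]
  · have hpot' : ∀ x ∈ convexHull ℝ (V : Set E),
        (σ.calls + 1) * lineDecrease B (σ.gap / K) + (f σ'.point - f x) ≤
          (M + 1) * (j + 1) * lineDecrease B (σ.gap / K) := fun x hx => by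
      linarith [hpot x hx]
    refine ⟨j, by rw [hg, hj], by rwa [hg], fun x hx => ?_, ?_, fun x hx => ?_⟩
    · rw [hg]; linarith [hprim x hx]
    -- With `x` the new iterate the primal gap vanishes, and the potential bound becomes a bound on
    -- the calls.
    · have := hpot' _ hval'.point_mem
      rw [sub_self, add_zero] at this
      rw [hc]; push_cast
      exact le_of_mul_le_mul_right this hδ
    · rw [hg, hc]; push_cast; exact hpot' x hx
  · have hprim' : ∀ x ∈ convexHull ℝ (V : Set E), f σ'.point - f x ≤ 2 * σ'.gap := by
      intro x hx
      have h1 := hf.lower σ.point x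
      have h2 := hdual x hx
      rw [← neg_sub σ.point x, inner_neg_right] at h1
      rw [hp, hg]
      have : 0 ≤ m * ‖-(σ.point - x)‖ ^ 2 := by positivity
      linarith
    -- The variation is at most `2 * σ.gap = 4 * σ'.gap`, hence the constant `(4κ)² / (4m) = 4κ² /
    -- m`.
    have hgeo : ∀ x ∈ convexHull ℝ (V : Set E),
        f σ'.point - f x ≤ (4 * κ ^ 2 / m) * σ'.gap ^ 2 := by
      intro x hx
      have h1 := hf.primal_gap_le hm (hκ σ.active hval.1 σ.point hval.2 x hx _ _
        (hval.inner_sub_le hact hdual))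
      rw [hp, hg]
      refine h1.trans (le_of_eq ?_)
      field_simp
      ring
    have hjj : (σ'.calls : ℝ) ≤ (M + 1) * (j + 1) + 1 := by
      rw [hc]; push_cast; linarith
    refine ⟨j + 1, by rw [hg, hj, pow_succ]; field_simp, Or.inr (by rw [hg]; linarith), hprim',
      ?_, fun x hx => ?_⟩
    · push_cast; linarith
    -- The false answer costs one call and the new phase is granted `M` decreases; together they are
    -- the extra `M + 1`.
    · have h1 := le_mul_lineDecrease hB hK (by positivity : 0 ≤ 4 * κ ^ 2 / m)
        (by rw [hg]; linarith : 0 ≤ σ'.gap) (hprim' x hx) (hgeo x hx)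
      have hδ' : 0 < lineDecrease B (σ'.gap / K) :=
        lineDecrease_pos hB (div_pos (by rw [hg]; linarith) hK)
      have h2 := mul_le_mul_of_nonneg_right hjj hδ'.le
      push_cast
      linarith

/-- The invariant holds at the start. -/
theorem bcgInit_invariant (hf : QuadraticBounds f m L) (hm : 0 < m) (hB : 0 < B) (hK : 0 < K)
    (hκ : ∀ S ⊆ V, ∀ u ∈ convexHull ℝ (S : Set E), ∀ x ∈ convexHull ℝ (V : Set E),
      ∀ (g : E) (G : ℝ), (∀ a ∈ S, ∀ v ∈ V, inner ℝ g (a - v) ≤ G) →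
        inner ℝ g (u - x) ≤ κ * G * ‖u - x‖) {u₀ : E} (hu₀ : u₀ ∈ V)
    (hΦ₀ : IsInitialGap f (convexHull ℝ (V : Set E)) u₀ Φ₀) :
    (bcgInit u₀ Φ₀).Invariant f V B K (4 * K + 4 * B * K ^ 2 * (4 * κ ^ 2 / m)) Φ₀ ε := by
  have hu₀' : u₀ ∈ convexHull ℝ (V : Set E) := subset_convexHull ℝ _ hu₀
  have hval : (bcgInit u₀ Φ₀).Valid V := by
    simp [bcgInit, BCGState.Valid, hu₀]
  have hΦ : 0 ≤ Φ₀ := by simpa using hΦ₀ u₀ hu₀'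
  have hdual : ∀ x ∈ convexHull ℝ (V : Set E), inner ℝ (gradient f u₀) (u₀ - x) ≤ 2 * Φ₀ :=
    fun x hx => by linarith [hΦ₀ x hx]
  have hprim : ∀ x ∈ convexHull ℝ (V : Set E), f u₀ - f x ≤ 2 * Φ₀ := by
    intro x hx
    have h1 := hf.lower u₀ x
    have h2 := hdual x hx
    rw [← neg_sub u₀ x, inner_neg_right] at h1
    have : 0 ≤ m * ‖-(u₀ - x)‖ ^ 2 := by positivity
    linarith
  have hgeo : ∀ x ∈ convexHull ℝ (V : Set E), f u₀ - f x ≤ (4 * κ ^ 2 / m) * Φ₀ ^ 2 := by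
    intro x hx
    -- The active set is a single vertex, so any nonnegative bound works; `2 * Φ₀` makes the total
    -- `4 * Φ₀` and reproduces the constant `4κ² / m`.
    have hact : ∀ a ∈ (bcgInit u₀ Φ₀).active, ∀ b ∈ (bcgInit u₀ Φ₀).active,
        inner ℝ (gradient f u₀) (a - b) ≤ 2 * Φ₀ := by
      simp [bcgInit, hΦ]
    have h1 := hf.primal_gap_le hm (hκ _ hval.1 u₀ hval.2 x hx _ _
      (hval.inner_sub_le hact hdual))
    refine h1.trans (le_of_eq ?_)
    field_simp
    ring
  have hM0 : 0 ≤ 4 * K + 4 * B * K ^ 2 * (4 * κ ^ 2 / m) := by positivity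
  refine ⟨hval, 0, by simp [bcgInit], Or.inl rfl, hprim, ?_, fun x hx => ?_⟩
  · simp only [bcgInit, Nat.cast_zero]; linarith
  · have h1 := le_mul_lineDecrease hB hK (by positivity : 0 ≤ 4 * κ ^ 2 / m) hΦ (hprim x hx)
      (hgeo x hx)
    have hδ : 0 ≤ lineDecrease B (Φ₀ / K) := le_min (by positivity) (by positivity)
    simp only [bcgInit, Nat.cast_zero, zero_mul, zero_add, mul_one]
    linarith

/-- Every execution over a polytope terminates. -/
theorem not_exists_bcg_run (hf : QuadraticBounds f m L) (hans : IsSeparation f ans V K)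
    (hR : ∀ v ∈ V, ‖v‖ ≤ R) (hL : 0 ≤ L) (hB : 0 < B)
    (hLB : L * (R ^ 2 * V.card) ≤ B) (hLB' : L * (2 * R) ^ 2 ≤ B) (hK : 0 < K)
    (hε : 0 < ε) (s : ℕ → BCGState E) (h0 : (s 0).Valid V)
    (hstep : ∀ t, BCGStep f ans ε (s t) (s (t + 1))) : False := by
  have hgap : ∀ t, ε / 2 < (s t).gap := fun t => by
    have := (hstep t).1
    rw [Stopped, not_le] at this; linarith
  have hspec := fun t (hv : (s t).Valid V) => (hstep t).2.spec hf hans hR hL hB hLB hLB' hK hv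
    (by linarith [hgap t])
  have hval : ∀ t, (s t).Valid V := by
    intro t
    induction t with
    | zero => exact h0
    | succ t ih => exact (hspec t ih).1
  obtain ⟨b, hb⟩ : ∃ b, ∀ u ∈ convexHull ℝ (V : Set E), b ≤ f u := by
    have := (V.finite_toSet.isCompact_convexHull (𝕜 := ℝ)).bddBelow_image hf.continuous.continuousOn
    obtain ⟨b, hb⟩ := this
    exact ⟨b, fun u hu => hb ⟨u, hu, rfl⟩⟩
  set δ := min ((ε / 2) ^ 2 / (16 * B)) (lineDecrease B (ε / 2 / K)) with hδ
  have hδ0 : 0 < δ := lt_min (by positivity) (lineDecrease_pos hB (by positivity))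
  -- A potential that loses at least `1` per step. The factor `2 / δ` gives a drop of `2`, enough to
  -- pay for the vertex a Frank-Wolfe step may add; `4 / ε` makes a halving worth at least `1`,
  -- since the gap exceeds `ε / 2`.
  let pot : ℕ → ℝ := fun t =>
    2 / δ * (f (s t).point - b) + 4 / ε * (s t).gap + (s t).active.card
  have hpot0 : ∀ t, 0 ≤ pot t := fun t => by
    have h1 := hb _ (hval t).point_mem
    have h2 := hgap t
    have h3 : 0 ≤ 2 / δ * (f (s t).point - b) := mul_nonneg (by positivity) (by linarith)
    have h4 : 0 ≤ 4 / ε * (s t).gap := mul_nonneg (by positivity) (by linarith)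
    positivity
  have hdrop : ∀ {a a' : ℝ}, a' ≤ a - δ → 2 / δ * (a' - b) ≤ 2 / δ * (a - b) - 2 := by
    intro a a' h
    have : 2 / δ * (a' - b) ≤ 2 / δ * (a - δ - b) := by gcongr
    have e : 2 / δ * (a - δ - b) = 2 / δ * (a - b) - 2 := by
      field_simp
      ring
    linarith
  have hdec : ∀ t, pot (t + 1) ≤ pot t - 1 := by
    intro t
    have hg := hgap t
    simp only [pot]
    rcases (hspec t (hval t)).2 with ⟨h1, -, ⟨h2, h3⟩ | ⟨h2, h3⟩⟩ | ⟨h1, -, h2, h3⟩ |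
      ⟨h1, -, h2, h3, -⟩
    · have h4 : 2 / δ * (f (s (t + 1)).point - b) ≤ 2 / δ * (f (s t).point - b) := by gcongr
      have h5 : ((s (t + 1)).active.card : ℝ) + 1 ≤ (s t).active.card := by exact_mod_cast h3
      rw [h1]; linarith
    · have h4 : δ ≤ (s t).gap ^ 2 / (16 * B) := (min_le_left _ _).trans (by gcongr)
      have h5 := hdrop (h2.trans (by linarith : _ ≤ f (s t).point - δ))
      have h6 : ((s (t + 1)).active.card : ℝ) ≤ (s t).active.card := by exact_mod_cast h3
      rw [h1]; linarith
    · have h4 : δ ≤ lineDecrease B ((s t).gap / K) :=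
        (min_le_right _ _).trans (lineDecrease_mono hB (by positivity) (by gcongr))
      have h5 := hdrop (h2.trans (by linarith : _ ≤ f (s t).point - δ))
      have h6 : ((s (t + 1)).active.card : ℝ) ≤ (s t).active.card + 1 := by exact_mod_cast h3
      rw [h1]; linarith
    · rw [h1, h2, h3]
      have h4 : 1 ≤ 2 / ε * (s t).gap := by
        rw [div_mul_eq_mul_div, one_le_div hε]; linarith
      have e : 4 / ε * ((s t).gap / 2) = 4 / ε * (s t).gap - 2 / ε * (s t).gap := by ring
      linarith
  have hlin : ∀ t : ℕ, pot t ≤ pot 0 - t := by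
    intro t
    induction t with
    | zero => simp
    | succ t ih => push_cast; linarith [hdec t]
  obtain ⟨t, ht⟩ := exists_nat_gt (pot 0)
  linarith [hlin t, hpot0 t]

/-- Linear convergence of Blended Conditional Gradients over a polytope, counted in calls to the
weak separation oracle. -/
theorem exists_bcg_bound (V : Finset E) {m L K : ℝ} (hm : 0 < m) (hL : 0 ≤ L) (hK : 0 < K) :
    ∃ C : ℝ, 0 < C ∧ ∀ (f : E → ℝ) (ans : ℕ → E → E → ℝ → Option E),
      QuadraticBounds f m L → IsSeparation f ans V K → ∀ u₀ ∈ V, ∀ Φ₀ : ℝ,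
      IsInitialGap f (convexHull ℝ (V : Set E)) u₀ Φ₀ → ∀ ε : ℝ, 0 < ε →
        (¬ ∃ s : ℕ → BCGState E, s 0 = bcgInit u₀ Φ₀ ∧
          ∀ t, BCGStep f ans ε (s t) (s (t + 1))) ∧
        ∀ σ : BCGState E, Relation.ReflTransGen (BCGStep f ans ε) (bcgInit u₀ Φ₀) σ →
          (¬ Stopped ε σ → ∃ σ', BCGStep f ans ε σ σ') ∧
          (σ.calls : ℝ) ≤ C * (1 + Real.log (1 + Φ₀ / ε)) ∧
          (Stopped ε σ → σ.point ∈ convexHull ℝ (V : Set E) ∧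
            ∀ x ∈ convexHull ℝ (V : Set E), f σ.point ≤ f x + ε) := by
  obtain ⟨κ, -, hκ⟩ := exists_inner_sub_le V
  obtain ⟨R, hR⟩ : ∃ R, ∀ v ∈ V, ‖v‖ ≤ R :=
    ⟨∑ v ∈ V, ‖v‖, fun v hv => Finset.single_le_sum (fun v _ => norm_nonneg v) hv⟩
  -- One constant dominates both curvature bounds; the summand `1` keeps it positive when `L` or `R`
  -- is zero.
  set B := L * (R ^ 2 * V.card) + L * (2 * R) ^ 2 + 1 with hB'
  have h1 : 0 ≤ L * (R ^ 2 * V.card) := by positivity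
  have h2 : 0 ≤ L * (2 * R) ^ 2 := by positivity
  have hB : 0 < B := by linarith
  have hLB : L * (R ^ 2 * V.card) ≤ B := by linarith
  have hLB' : L * (2 * R) ^ 2 ≤ B := by linarith
  set M := 4 * K + 4 * B * K ^ 2 * (4 * κ ^ 2 / m) with hM
  have hM0 : 0 ≤ M := by positivity
  refine ⟨3 * (M + 1), by positivity, fun f ans hf hans u₀ hu₀ Φ₀ hΦ₀ ε hε => ?_⟩
  have hinit := bcgInit_invariant (ε := ε) hf hm hB hK hκ hu₀ hΦ₀
  have hΦ : 0 ≤ Φ₀ := by simpa using hΦ₀ u₀ (subset_convexHull ℝ _ hu₀)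
  refine ⟨fun ⟨s, hs0, hs⟩ => not_exists_bcg_run hf hans hR hL hB hLB hLB' hK hε s
    (hs0 ▸ hinit.1) hs, fun σ hσ => ?_⟩
  have hinv : σ.Invariant f V B K M Φ₀ ε := by
    induction hσ with
    | refl => exact hinit
    | tail _ hst ih => exact ih.step hf hans hR hm hL hB hLB hLB' hK hκ hε hst
  obtain ⟨hval, j, hj, hj', hprim, hcalls, -⟩ := hinv
  refine ⟨fun hns => ?_, ?_, fun hst => ⟨hval.point_mem, fun x hx => ?_⟩⟩
  · have hgap : 0 < σ.gap := by
      rw [Stopped, not_le] at hns; linarith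
    obtain ⟨σ', h⟩ := exists_bcgIteration (ans := ans) hf.continuous hval hgap
    exact ⟨σ', hns, h⟩
  · have := natCast_le_log_of_lt_div_two_pow hΦ hε (hj ▸ hj')
    calc (σ.calls : ℝ) ≤ (M + 1) * (j + 1) := hcalls
      _ ≤ (M + 1) * (3 * (1 + Real.log (1 + Φ₀ / ε))) := by
          have : 0 ≤ Real.log (1 + Φ₀ / ε) := Real.log_nonneg (by
            have : 0 ≤ Φ₀ / ε := by positivity
            linarith)
          gcongr
          linarith
      _ = _ := by ring
  · have := hprim x hx
    have h3 : 2 * σ.gap ≤ ε := hst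
    linarith

end BCG

/-! ### The unit ball of the gauge norm -/

section Tensors

variable {p : ℕ} {r : Fin p → ℕ} {lam : ℝ}

theorem finite_rankOneSign (r : Fin p → ℕ) (lam : ℝ) : (rankOneSign r lam).Finite := by
  have hfin : {θ : (k : Fin p) → Fin (r k) → ℝ |
      ∀ k, θ k ∈ {η | ∀ j, η j ∈ ({-1, 1} : Set ℝ)}}.Finite :=
    Set.Finite.pi' fun k => Set.Finite.pi' fun j => Set.toFinite _
  refine (hfin.image fun θ => (WithLp.toLp 2 fun x => lam * ∏ k, θ k (x k) : Tensor r)).subset ?_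
  rintro ψ ⟨θ, hθ, hψ⟩
  exact ⟨θ, hθ, by ext x; exact (hψ x).symm⟩

/-- The tensor is linear in each factor separately, and the cube `[-1, 1]^(r a)` is the hull of its
sign vectors. Factors are thus rounded one at a time; `s` collects those not yet known to be signs.
-/
theorem toLp_mem_convexHull_rankOneSign (s : Finset (Fin p)) (θ : (k : Fin p) → Fin (r k) → ℝ)
    (hθ : ∀ k j, θ k j ∈ Set.Icc (-1 : ℝ) 1) (hs : ∀ k ∉ s, ∀ j, θ k j = -1 ∨ θ k j = 1) :
    (WithLp.toLp 2 fun x => lam * ∏ k, θ k (x k) : Tensor r) ∈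
      convexHull ℝ (rankOneSign r lam) := by
  induction s using Finset.induction_on generalizing θ with
  | empty => exact subset_convexHull ℝ _ ⟨θ, fun k j => hs k (by simp) j, fun x => rfl⟩
  | insert a s has ih =>
    let T : (Fin (r a) → ℝ) → Tensor r := fun η =>
      WithLp.toLp 2 fun x => lam * ∏ k, Function.update θ a η k (x k)
    have hprod : ∀ η (x : Idx r), ∏ k, Function.update θ a η k (x k) =
        η (x a) * ∏ k ∈ Finset.univ.erase a, θ k (x k) := by
      intro η x
      rw [← Finset.mul_prod_erase _ _ (Finset.mem_univ a), Function.update_self]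
      congr 1
      refine Finset.prod_congr rfl fun k hk => ?_
      rw [Function.update_of_ne (Finset.ne_of_mem_erase hk)]
    have hlin : IsLinearMap ℝ T := by
      constructor
      · intro η η'
        ext x
        simp only [T, hprod, PiLp.add_apply, Pi.add_apply]
        ring
      · intro c η
        ext x
        simp only [T, hprod, PiLp.smul_apply, Pi.smul_apply, smul_eq_mul]
        ring
    have hsub : convexHull ℝ (Set.pi Set.univ fun _ : Fin (r a) => ({-1, 1} : Set ℝ)) ⊆
        T ⁻¹' convexHull ℝ (rankOneSign r lam) := by
      refine convexHull_min (fun η hη => ?_) ((convex_convexHull ℝ _).is_linear_preimage hlin)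
      have hη' : ∀ j, η j = -1 ∨ η j = 1 := fun j => hη j (Set.mem_univ j)
      refine ih _ (fun k j => ?_) (fun k hk j => ?_)
      · by_cases h : k = a
        · subst h
          rw [Function.update_self]
          rcases hη' j with h | h <;> rw [h] <;> norm_num
        · rw [Function.update_of_ne h]
          exact hθ k j
      · by_cases h : k = a
        · subst h
          rw [Function.update_self]
          exact hη' j
        · rw [Function.update_of_ne h]
          exact hs k (by simp [h, hk]) j
    rw [convexHull_pi] at hsub
    have hmem : θ a ∈ Set.pi Set.univ fun _ : Fin (r a) => convexHull ℝ ({-1, 1} : Set ℝ) := by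
      intro j _
      rw [convexHull_pair, segment_eq_Icc (by norm_num)]
      exact hθ a j
    have := hsub hmem
    simpa only [Set.mem_preimage, T, Function.update_eq_self] using this

/-- The sign tensors contain all extreme points of `C_λ`. -/
theorem hull_eq_convexHull_rankOneSign (r : Fin p → ℕ) (lam : ℝ) :
    hull r lam = convexHull ℝ (rankOneSign r lam) := by
  refine Set.Subset.antisymm (convexHull_min ?_ (convex_convexHull ℝ _)) (convexHull_mono ?_)
  · rintro ψ ⟨θ, hθ, hψ⟩
    have : ψ = WithLp.toLp 2 fun x => lam * ∏ k, θ k (x k) := by ext x; exact hψ x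
    rw [this]
    exact toLp_mem_convexHull_rankOneSign Finset.univ θ hθ (by simp)
  · rintro ψ ⟨θ, hθ, hψ⟩
    exact ⟨θ, fun k j => by rcases hθ k j with h | h <;> rw [h] <;> norm_num, hψ⟩

theorem convex_hull (r : Fin p → ℕ) (lam : ℝ) : Convex ℝ (hull r lam) :=
  convex_convexHull ℝ _

theorem isCompact_hull (r : Fin p → ℕ) (lam : ℝ) : IsCompact (hull r lam) := by
  rw [hull_eq_convexHull_rankOneSign]
  exact (finite_rankOneSign r lam).isCompact_convexHull (𝕜 := ℝ)

theorem hull_eq_smul (r : Fin p → ℕ) (lam : ℝ) : hull r lam = lam • hull r 1 := by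
  rw [hull, hull, ← convexHull_smul]
  congr 1
  ext ψ
  constructor
  · rintro ⟨θ, hθ, hψ⟩
    refine ⟨WithLp.toLp 2 fun x => ∏ k, θ k (x k), ⟨θ, hθ, fun x => by simp⟩, ?_⟩
    ext x
    simp [hψ x]
  · rintro ⟨φ, ⟨θ, hθ, hφ⟩, rfl⟩
    exact ⟨θ, hθ, fun x => by simp [hφ x]⟩

theorem zero_mem_hull (hp : 0 < p) (r : Fin p → ℕ) (lam : ℝ) : (0 : Tensor r) ∈ hull r lam := by
  refine subset_convexHull ℝ _ ⟨fun _ _ => 0, fun k j => by norm_num, fun x => ?_⟩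
  -- With `p = 0` the product would be empty and equal to `1`, hence the need for `0 < p`.
  rw [Finset.prod_const, Finset.card_univ, Fintype.card_fin, zero_pow hp.ne']
  simp

theorem neg_mem_rankOneBox (hp : 0 < p) {ψ : Tensor r} (h : ψ ∈ rankOneBox r lam) :
    -ψ ∈ rankOneBox r lam := by
  obtain ⟨θ, hθ, hψ⟩ := h
  let e : Fin p → ℝ := fun k => if k = ⟨0, hp⟩ then -1 else 1
  refine ⟨fun k j => e k * θ k j, fun k j => ?_, fun x => ?_⟩
  · have := hθ k j
    rw [Set.mem_Icc] at this ⊢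
    simp only [e]
    split_ifs <;> constructor <;> linarith
  · rw [Finset.prod_mul_distrib]
    simp only [e, Finset.prod_ite_eq', Finset.mem_univ, if_true, PiLp.neg_apply, hψ x]
    ring

theorem single_mem_rankOneBox (x : Idx r) :
    (EuclideanSpace.single x 1 : Tensor r) ∈ rankOneBox r 1 := by
  refine ⟨fun k j => if j = x k then 1 else 0, fun k j => ?_, fun z => ?_⟩
  · beta_reduce
    split_ifs <;> norm_num
  · rw [Finset.prod_ite_zero, PiLp.single_apply]
    simp [funext_iff]

/-- `C₁` is absorbing. -/
theorem exists_mem_smul_hull (hp : 0 < p) (ψ : Tensor r) : ∃ s : ℝ, 0 ≤ s ∧ ψ ∈ s • hull r 1 := by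
  classical
  have hsum : ψ = ∑ x, ψ x • EuclideanSpace.single x (1 : ℝ) := by
    ext z
    simp [Pi.single_apply]
  rw [hsum]
  generalize (Finset.univ : Finset (Idx r)) = t
  induction t using Finset.induction_on with
  | empty => exact ⟨0, le_rfl, 0, zero_mem_hull hp r 1, by simp⟩
  | insert a t ha ih =>
    obtain ⟨s, hs, hmem⟩ := ih
    refine ⟨|ψ a| + s, by positivity, ?_⟩
    rw [Finset.sum_insert ha, (convex_hull r 1).add_smul (abs_nonneg _) hs]
    refine Set.add_mem_add ?_ hmem
    have h1 := single_mem_rankOneBox a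
    rcases abs_cases (ψ a) with ⟨h, -⟩ | ⟨h, -⟩
    · exact ⟨_, subset_convexHull ℝ _ h1, by rw [h]⟩
    · exact ⟨_, subset_convexHull ℝ _ (neg_mem_rankOneBox hp h1), by rw [h]; simp⟩

/-- The infimum in the gauge norm is attained. -/
theorem mem_gaugeNorm_smul_hull (hp : 0 < p) (ψ : Tensor r) :
    0 ≤ gaugeNorm ψ ∧ ψ ∈ gaugeNorm ψ • hull r 1 := by
  have hbdd : BddBelow {s : ℝ | 0 ≤ s ∧ ψ ∈ s • hull r 1} := ⟨0, fun s hs => hs.1⟩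
  refine IsClosed.csInf_mem (s := {s : ℝ | 0 ≤ s ∧ ψ ∈ s • hull r 1}) ?_
    (exists_mem_smul_hull hp ψ) hbdd
  have : {s : ℝ | 0 ≤ s ∧ ψ ∈ s • hull r 1} =
      Set.Ici 0 ∩ Prod.fst '' ((Set.univ ×ˢ hull r 1) ∩ {q : ℝ × Tensor r | q.1 • q.2 = ψ}) := by
    ext s
    constructor
    · rintro ⟨hs, φ, hφ, h⟩
      exact ⟨hs, (s, φ), ⟨⟨Set.mem_univ _, hφ⟩, h⟩, rfl⟩
    · rintro ⟨hs, ⟨s', φ⟩, ⟨⟨-, hφ⟩, h⟩, rfl⟩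
      exact ⟨hs, φ, hφ, h⟩
  rw [this]
  refine isClosed_Ici.inter ?_
  rw [← isSeqClosed_iff_isClosed]
  intro u s hu hlim
  choose q hq hqu using hu
  -- Compactness of `C₁` yields a limit of the witnesses, so the set of admissible scalings is
  -- closed.
  obtain ⟨φ, hφ, g, hg, hφlim⟩ := (isCompact_hull r 1).tendsto_subseq fun i => (hq i).1.2
  refine ⟨(s, φ), ⟨⟨Set.mem_univ _, hφ⟩, ?_⟩, rfl⟩
  have h1 := (hlim.comp hg.tendsto_atTop).smul hφlim
  refine tendsto_nhds_unique h1 ?_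
  have : (fun i => (u ∘ g) i • ((fun i => (q i).2) ∘ g) i) = fun _ => ψ := by
    funext i
    have := (hq (g i)).2
    simp only [Function.comp, ← hqu]
    exact this
  have h2 := tendsto_const_nhds (x := ψ) (f := (Filter.atTop : Filter ℕ))
  rw [← this] at h2
  exact h2

/-- Since the infimum is attained and `C₁` contains `0`, shrinking stays inside: `s C₁ ⊆ lam C₁` for
`0 ≤ s ≤ lam`. The case `lam = 0` is separate because of the division by `lam`. -/
theorem feasible_eq_hull (hp : 0 < p) (r : Fin p → ℕ) (hlam : 0 ≤ lam) :
    feasible r lam = hull r lam := by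
  ext ψ
  constructor
  · intro h
    have h : gaugeNorm ψ ≤ lam := h
    obtain ⟨h0, φ, hφ, hφψ⟩ := mem_gaugeNorm_smul_hull hp ψ
    beta_reduce at hφψ
    rw [hull_eq_smul]
    rcases hlam.eq_or_lt with rfl | hpos
    · have h1 : gaugeNorm ψ = 0 := le_antisymm h h0
      exact ⟨φ, hφ, by rw [← hφψ, h1]⟩
    · refine ⟨(gaugeNorm ψ / lam) • φ, (convex_hull r 1).smul_mem_of_zero_mem
        (zero_mem_hull hp r 1) hφ ⟨by positivity, (div_le_one hpos).2 h⟩, ?_⟩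
      change lam • (gaugeNorm ψ / lam) • φ = ψ
      rw [smul_smul, mul_div_cancel₀ _ hpos.ne', hφψ]
  · intro h
    rw [hull_eq_smul] at h
    exact csInf_le (s := {s : ℝ | 0 ≤ s ∧ ψ ∈ s • hull r 1}) ⟨0, fun s hs => hs.1⟩ ⟨hlam, h⟩

end Tensors

/-! ### The projected problem -/

theorem hasGradientAt_of_abs_le {E : Type*} [NormedAddCommGroup E] [InnerProductSpace ℝ E]
    [CompleteSpace E] {f : E → ℝ} {g u : E} {L : ℝ}
    (h : ∀ w, |f w - f u - inner ℝ g (w - u)| ≤ L * ‖w - u‖ ^ 2) : HasGradientAt f g u := by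
  rw [hasGradientAt_iff_isLittleO]
  refine Asymptotics.IsBigO.trans_isLittleO ?_ (Asymptotics.isLittleO_pow_sub_sub u one_lt_two)
  refine Asymptotics.IsBigO.of_bound L (Filter.Eventually.of_forall fun w => ?_)
  rw [Real.norm_eq_abs, norm_pow, norm_norm]
  exact h w

theorem QuadraticBounds.strictConvexOn {E : Type*} [NormedAddCommGroup E] [InnerProductSpace ℝ E]
    [CompleteSpace E] {f : E → ℝ} {m L : ℝ} (hf : QuadraticBounds f m L) (hm : 0 < m) {s : Set E}
    (hs : Convex ℝ s) : StrictConvexOn ℝ s f := by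
  refine ⟨hs, fun u _ w _ huw a b ha hb hab => ?_⟩
  set z := a • u + b • w with hz
  -- The lower models at `z` are averaged with weights `a`, `b`; their linear terms cancel and the
  -- quadratic terms give strictness.
  have h1 := mul_le_mul_of_nonneg_left (hf.lower z u) ha.le
  have h2 := mul_le_mul_of_nonneg_left (hf.lower z w) hb.le
  have hb' : b = 1 - a := by linarith
  have huz : u - z = b • (u - w) := by
    rw [hz, hb']; module
  have hwz : w - z = -(a • (u - w)) := by
    rw [hz, hb']; module
  have hpos : 0 < ‖u - w‖ := norm_pos_iff.2 (sub_ne_zero.2 huw)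
  rw [huz, inner_smul_right, norm_smul, Real.norm_of_nonneg hb.le] at h1
  rw [hwz, inner_neg_right, inner_smul_right, norm_neg, norm_smul, Real.norm_of_nonneg ha.le] at h2
  have h3 : 0 < a * (m * (b * ‖u - w‖) ^ 2) := by positivity
  have h4 : 0 < b * (m * (a * ‖u - w‖) ^ 2) := by positivity
  have e : f z = a * f z + b * f z := by rw [← add_mul, hab, one_mul]
  simp only [smul_eq_mul]
  rw [e]
  linarith

section Projection

variable {p n : ℕ} {r : Fin p → ℕ} (x : Fin n → Idx r)

theorem isLinearMap_proj : IsLinearMap ℝ (proj x) :=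
  ⟨fun _ _ => rfl, fun _ _ => rfl⟩

theorem inner_extendZero (c : EuclideanSpace ℝ (Observed x)) (ψ : Tensor r) :
    inner ℝ (extendZero x c) ψ = inner ℝ c (proj x ψ) := by
  simp only [PiLp.inner_apply, extendZero, proj]
  rw [← Finset.sum_subset (Finset.subset_univ (Finset.univ.image x)) fun z _ hz => by simp [hz],
    ← Finset.sum_coe_sort]
  refine Finset.sum_congr rfl fun z _ => ?_
  rw [dif_pos z.2]

/-- The projected feasible set is the polytope spanned by the projected sign tensors. -/
theorem proj_image_hull (lam : ℝ) :
    proj x '' hull r lam = convexHull ℝ (proj x '' rankOneSign r lam) := by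
  rw [hull_eq_convexHull_rankOneSign]
  exact ((isLinearMap_proj x).mk' _).image_convexHull _

/-- Every index in `U` is observed at least once. This is the source of strong convexity, which
unobserved entries would destroy. -/
theorem norm_sq_le_sum (d : EuclideanSpace ℝ (Observed x)) :
    ‖d‖ ^ 2 ≤ ∑ i, d (observedIdx x i) ^ 2 := by
  have hsurj : ∀ z : Observed x, ∃ i, observedIdx x i = z := by
    rintro ⟨z, hz⟩
    obtain ⟨i, -, hi⟩ := Finset.mem_image.1 hz
    exact ⟨i, Subtype.ext hi⟩
  choose s hs using hsurj
  have hinj : Function.Injective s := fun a b h => by rw [← hs a, ← hs b, h]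
  rw [EuclideanSpace.norm_sq_eq]
  calc ∑ z, ‖d z‖ ^ 2 = ∑ z, d (observedIdx x (s z)) ^ 2 :=
        Finset.sum_congr rfl fun z _ => by rw [hs, Real.norm_eq_abs, sq_abs]
    _ = ∑ i ∈ Finset.univ.map ⟨s, hinj⟩, d (observedIdx x i) ^ 2 := by
        rw [Finset.sum_map]; rfl
    _ ≤ _ := Finset.sum_le_sum_of_subset_of_nonneg (Finset.subset_univ _)
        fun i _ _ => sq_nonneg _

theorem sum_le_norm_sq (d : EuclideanSpace ℝ (Observed x)) :
    ∑ i, d (observedIdx x i) ^ 2 ≤ n * ‖d‖ ^ 2 := by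
  calc ∑ i, d (observedIdx x i) ^ 2 ≤ ∑ _i : Fin n, ‖d‖ ^ 2 := by
        refine Finset.sum_le_sum fun i _ => ?_
        rw [← sq_abs, ← Real.norm_eq_abs]
        have := PiLp.norm_apply_le d (observedIdx x i)
        gcongr
    _ = n * ‖d‖ ^ 2 := by simp

/-- The objective is quadratic, so its second-order expansion is exact. The quadratic term does not
involve `y`, which makes the curvature constants independent of the data. -/
theorem projObjective_expansion (y : Fin n → ℝ) (u w : EuclideanSpace ℝ (Observed x)) :
    projObjective x y w = projObjective x y u +
      inner ℝ (∑ i, (2 / (n : ℝ) * (u (observedIdx x i) - y i)) •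
        EuclideanSpace.single (observedIdx x i) (1 : ℝ)) (w - u) +
      1 / (n : ℝ) * ∑ i, (w - u) (observedIdx x i) ^ 2 := by
  simp only [projObjective, sum_inner, inner_smul_left, EuclideanSpace.inner_single_left,
    Finset.mul_sum, ← Finset.sum_add_distrib]
  refine Finset.sum_congr rfl fun i _ => ?_
  simp only [PiLp.sub_apply, conj_trivial]
  ring

/-- The projected objective is strongly convex and smooth. -/
theorem quadraticBounds_projObjective (hn : 0 < n) (y : Fin n → ℝ) :
    QuadraticBounds (projObjective x y) (1 / (n : ℝ)) 1 := by
  have hn' : (0 : ℝ) < n := by exact_mod_cast hn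
  have hup : ∀ d : EuclideanSpace ℝ (Observed x),
      1 / (n : ℝ) * ∑ i, d (observedIdx x i) ^ 2 ≤ 1 * ‖d‖ ^ 2 := by
    intro d
    rw [one_mul, one_div, inv_mul_le_iff₀ hn']
    exact sum_le_norm_sq x d
  have hgrad : ∀ u, gradient (projObjective x y) u =
      ∑ i, (2 / (n : ℝ) * (u (observedIdx x i) - y i)) •
        EuclideanSpace.single (observedIdx x i) (1 : ℝ) := by
    intro u
    refine (hasGradientAt_of_abs_le (L := 1) fun w => ?_).gradient
    rw [projObjective_expansion x y u w, add_assoc, add_sub_cancel_left, add_sub_cancel_left,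
      abs_of_nonneg]
    · exact hup _
    · exact mul_nonneg (by positivity) (Finset.sum_nonneg fun i _ => sq_nonneg _)
  refine ⟨by unfold projObjective; fun_prop, fun u w => ?_, fun u w => ?_⟩
  · rw [hgrad, projObjective_expansion x y u w]
    have := norm_sq_le_sum x (w - u)
    gcongr
  · rw [hgrad, projObjective_expansion x y u w]
    have := hup (w - u)
    gcongr

theorem isSeparation_projAnswer {lam K : ℝ} (f : EuclideanSpace ℝ (Observed x) → ℝ)
    (O : WeakSeparationOracle r lam K) {lift : ℕ → EuclideanSpace ℝ (Observed x) → Tensor r}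
    (hlift : IsLift x lam lift) {V : Finset (EuclideanSpace ℝ (Observed x))}
    (hV : (V : Set (EuclideanSpace ℝ (Observed x))) = proj x '' rankOneSign r lam) :
    IsSeparation f (projAnswer x O lift) V K := by
  have hinner : ∀ j, ∀ u ∈ convexHull ℝ (V : Set (EuclideanSpace ℝ (Observed x))), ∀ c φ,
      lift j u ∈ hull r lam ∧
      inner ℝ (extendZero x c) (lift j u - φ) = inner ℝ c (u - proj x φ) := by
    intro j u hu c φ
    rw [hV, ← proj_image_hull] at hu
    obtain ⟨h1, h2⟩ := hlift j u hu
    exact ⟨h1, by rw [inner_extendZero, (isLinearMap_proj x).map_sub, h2]⟩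
  refine ⟨fun j u hu Φ v hΦ h => ?_, fun j u hu Φ hΦ h v hv => ?_⟩
  · obtain ⟨φ, hφ, rfl⟩ := Option.map_eq_some_iff.1 h
    obtain ⟨h1, h2⟩ := O.sound_vertex j _ _ Φ φ (hinner j u hu (gradient f u) φ).1 hΦ hφ
    rw [(hinner j u hu (gradient f u) φ).2] at h2
    refine ⟨?_, h2⟩
    rw [← Finset.mem_coe, hV]
    exact ⟨φ, h1, rfl⟩
  · rw [hV, ← proj_image_hull] at hv
    obtain ⟨φ, hφ, rfl⟩ := hv
    have h1 := O.sound_false j _ _ Φ (hinner j u hu (gradient f u) φ).1 hΦ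
      (Option.map_eq_none_iff.1 h) φ hφ
    rwa [(hinner j u hu (gradient f u) φ).2] at h1

end Projection

end TensorCompletion

theorem mainTheorem6 {p : ℕ} (hp : 0 < p) (r : Fin p → ℕ) {n : ℕ} (hn : 0 < n)
    (x : Fin n → TensorCompletion.Idx r) (lam : ℝ) (hlam : 0 ≤ lam) (K : ℝ) (hK : 1 ≤ K) :
    -- the projected feasible set is a polytope
    ((TensorCompletion.proj x '' TensorCompletion.rankOneSign r lam).Finite ∧
      TensorCompletion.proj x '' TensorCompletion.feasible r lam =
        convexHull ℝ (TensorCompletion.proj x '' TensorCompletion.rankOneSign r lam)) ∧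
    -- the objective factors through the projection and is strictly convex on the polytope
    (∀ y : Fin n → ℝ,
      (∀ ψ : TensorCompletion.Tensor r, TensorCompletion.objective x y ψ =
        TensorCompletion.projObjective x y (TensorCompletion.proj x ψ)) ∧
      StrictConvexOn ℝ (TensorCompletion.proj x '' TensorCompletion.feasible r lam)
        (TensorCompletion.projObjective x y)) ∧
    -- linear number of oracle calls
    ∃ C : ℝ, 0 < C ∧
      ∀ (y : Fin n → ℝ) (O : TensorCompletion.WeakSeparationOracle r lam K)
        (lift : ℕ → EuclideanSpace ℝ (TensorCompletion.Observed x) → TensorCompletion.Tensor r),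
        TensorCompletion.IsLift x lam lift →
      ∀ φ₀ ∈ TensorCompletion.rankOneSign r lam, ∀ Φ₀ : ℝ,
        TensorCompletion.IsInitialGap (TensorCompletion.projObjective x y)
          (TensorCompletion.proj x '' TensorCompletion.feasible r lam)
          (TensorCompletion.proj x φ₀) Φ₀ →
      ∀ ε : ℝ, 0 < ε →
        -- every execution terminates
        (¬ ∃ s : ℕ → TensorCompletion.BCGState (EuclideanSpace ℝ (TensorCompletion.Observed x)),
          s 0 = TensorCompletion.bcgInit (TensorCompletion.proj x φ₀) Φ₀ ∧
          ∀ t, TensorCompletion.BCGStep (TensorCompletion.projObjective x y)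
            (TensorCompletion.projAnswer x O lift) ε (s t) (s (t + 1))) ∧
        ∀ σ : TensorCompletion.BCGState (EuclideanSpace ℝ (TensorCompletion.Observed x)),
          Relation.ReflTransGen
            (TensorCompletion.BCGStep (TensorCompletion.projObjective x y)
              (TensorCompletion.projAnswer x O lift) ε)
            (TensorCompletion.bcgInit (TensorCompletion.proj x φ₀) Φ₀) σ →
          -- an execution that has not reached the stopping rule can be continued
          (¬ TensorCompletion.Stopped ε σ →
            ∃ σ', TensorCompletion.BCGStep (TensorCompletion.projObjective x y)
              (TensorCompletion.projAnswer x O lift) ε σ σ') ∧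
          -- bound on the number of oracle calls
          (σ.calls : ℝ) ≤ C * (1 + Real.log (1 + Φ₀ / ε)) ∧
          -- on termination every feasible tensor over the iterate solves the problem up to `ε`
          (TensorCompletion.Stopped ε σ →
            σ.point ∈ TensorCompletion.proj x '' TensorCompletion.feasible r lam ∧
            ∀ ψ ∈ TensorCompletion.feasible r lam, TensorCompletion.proj x ψ = σ.point →
              ∀ φ ∈ TensorCompletion.feasible r lam,
                TensorCompletion.objective x y ψ ≤ TensorCompletion.objective x y φ + ε) := by
  classical
  have hfin := (TensorCompletion.finite_rankOneSign r lam).image (TensorCompletion.proj x)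
  have himg : TensorCompletion.proj x '' TensorCompletion.feasible r lam =
      convexHull ℝ (TensorCompletion.proj x '' TensorCompletion.rankOneSign r lam) := by
    rw [TensorCompletion.feasible_eq_hull hp r hlam, TensorCompletion.proj_image_hull]
  have hn' : (0 : ℝ) < 1 / n := by positivity
  refine ⟨⟨hfin, himg⟩, fun y => ⟨fun ψ => rfl, ?_⟩, ?_⟩
  · rw [himg]
    exact (TensorCompletion.quadraticBounds_projObjective x hn y).strictConvexOn hn'
      (convex_convexHull ℝ _)
  -- The constant is fixed before `y` and the oracle are introduced: it depends on the vertices, the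
  -- curvatures `1/n` and `1`, and `K` only.
  obtain ⟨C, hC, h⟩ := TensorCompletion.exists_bcg_bound hfin.toFinset hn' zero_le_one
    (zero_lt_one.trans_le hK)
  refine ⟨C, hC, fun y O lift hlift φ₀ hφ₀ Φ₀ hΦ₀ ε hε => ?_⟩
  rw [hfin.coe_toFinset, ← himg] at h
  obtain ⟨hterm, hrun⟩ := h _ _ (TensorCompletion.quadraticBounds_projObjective x hn y)
    (TensorCompletion.isSeparation_projAnswer x _ O hlift hfin.coe_toFinset) _
    (hfin.mem_toFinset.2 ⟨φ₀, hφ₀, rfl⟩) Φ₀ hΦ₀ ε hε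
  refine ⟨hterm, fun σ hσ => ?_⟩
  obtain ⟨h1, h2, h3⟩ := hrun σ hσ
  refine ⟨h1, h2, fun hst => ⟨(h3 hst).1, fun ψ _ hψσ φ hφ => ?_⟩⟩
  have h4 := (h3 hst).2 _ ⟨φ, hφ, rfl⟩
  rw [← hψσ] at h4
  exact h4
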